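/- Let $\mathfrak B$ be a complex unital Banach algebra, let $d\in\mathbb N$, and let $\mathcal T:\mathbb R^d\to B(\mathfrak B)$ be a strongly continuous representation by isometric algebra automorphisms of $\mathfrak B$. For $f\in L^1(\mathbb R^d)$ and $x\in\mathfrak B$ put $fx=\int_{\mathbb R^d} f(g)\,\mathcal T(-g)x\,dg$. For $a\in\mathbb R^d$ let $\phi_a\in L^1(\mathbb R^d)$ be the function with Fourier transform $$\hat\phi_a(\lambda)=\int_{\mathbb R^d}\phi_a(t)e^{-it\cdot\lambda}\,dt=\prod_{k=1}^d\max\{1-|\lambda_k-a_k|,0\},\qquad \lambda\in\mathbb R^d .$$ The Wiener class and the Beurling class are $$\mathcal W=\Big\{x\in\mathfrak B:\int_{\mathbb R^d}\|\phi_a x\|\,da<\infty\Big\},\qquad \mathcal B=\Big\{x\in\mathfrak B:\sum_{k\in\mathbb Z^d}\ \sup_{n\in\mathbb Z^d,\,|n|_\infty\ge|k|_\infty}\|\phi_n x\|<\infty\Big\},$$ where $|k|_\infty=\max_j|k_j|$. For $k=1,\dots,d$ let $iA_k$ be the infinitesimal generator of the one-parameter group $t\mapsto\mathcal T(te_k)$,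 where $e_k$ is the $k$-th standard basis vector of $\mathbb R^d$, and for a multi-index $\alpha\in\mathbb Z_+^d$ let $A^\alpha=A_1^{\alpha_1}\cdots A_d^{\alpha_d}$ with its natural domain $D(A^\alpha)$ and $|\alpha|=\alpha_1+\dots+\alpha_d$. For $m\in\mathbb N$ and $\mathcal F\in\{\mathcal W,\mathcal B\}$ put $$\mathcal F^{(m)}=\{x\in\mathfrak B:\ x\in D(A^\alpha)\text{ and }A^\alpha x\in\mathcal F\text{ for all }\alpha\in\mathbb Z_+^d\text{ with }|\alpha|\le m\}.$$ Theorem. Both the Sobolev–Wiener class $\mathcal W^{(m)}$ and the Sobolev–Beurling class $\mathcal B^{(m)}$ are inverse-closed subalgebras of $\mathfrak B$: each is a unital subalgebra of $\mathfrak B$, and if $x\in\mathcal F^{(m)}$ is invertible in $\mathfrak B$, then $x^{-1}\in\mathcal F^{(m)}$. -/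

import Mathlib

open MeasureTheory
open scoped ENNReal

namespace SpectralDecay

noncomputable section

/-- A strongly continuous isometric representation `T : ℝ^d → B(X)` on a complex normed space. -/
structure IsIsometricRep {d : ℕ} {X : Type*} [NormedAddCommGroup X] [NormedSpace ℂ X]
    (T : (Fin d → ℝ) → X →L[ℂ] X) : Prop where
  map_zero : T 0 = ContinuousLinearMap.id ℂ X
  map_add : ∀ s t, T (s + t) = (T s).comp (T t)
  norm_map : ∀ t x, ‖T t x‖ = ‖x‖
  continuous : ∀ x, Continuous fun t => T t x

/-- A strongly continuous isometric representation of `ℝ^d` by automorphisms of the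
algebra `B`.  (Bijectivity and preservation of the unit follow from the fields.) -/
structure IsIsometricAutRep {d : ℕ} {B : Type*} [NormedRing B] [NormedAlgebra ℂ B]
    (T : (Fin d → ℝ) → B →L[ℂ] B) : Prop extends IsIsometricRep T where
  map_mul : ∀ t x y, T t (x * y) = T t x * T t y

/-- The module action `f x = ∫ f(g) T(-g) x dg` of a function `f ∈ L¹(ℝ^d)`. -/
def act {d : ℕ} {X : Type*} [NormedAddCommGroup X] [NormedSpace ℂ X]
    (T : (Fin d → ℝ) → X →L[ℂ] X) (f : (Fin d → ℝ) → ℂ) (x : X) : X :=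
  ∫ g : Fin d → ℝ, f g • T (-g) x

/-- The triangle function `(1 - |l|) χ_[-1,1](l)`. -/
def triangle (l : ℝ) : ℝ := max (1 - |l|) 0

/-- The Fourier transform of `phi a`: `l ↦ ∏ k, triangle (l k - a k)`. -/
def phiHat {d : ℕ} (a l : Fin d → ℝ) : ℝ := ∏ k, triangle (l k - a k)

/-- The function in `L¹(ℝ^d)` whose Fourier transform `∫ f(t) e^{-i t·l} dt` is `phiHat a`,
given as the inverse Fourier transform `(2π)^{-d} ∫ phiHat a l e^{i s·l} dl`. -/
def phi {d : ℕ} (a s : Fin d → ℝ) : ℂ :=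
  ((2 * Real.pi) ^ d : ℂ)⁻¹ *
    ∫ l : Fin d → ℝ, (phiHat a l : ℂ) * Complex.exp (Complex.I * ((∑ k, s k * l k : ℝ) : ℂ))

/-- The norm `∫_{ℝ^d} ‖phi a · x‖ da`, with value `∞` off the Wiener class. -/
def wienerNorm {d : ℕ} {X : Type*} [NormedAddCommGroup X] [NormedSpace ℂ X]
    (T : (Fin d → ℝ) → X →L[ℂ] X) (x : X) : ℝ≥0∞ :=
  ∫⁻ a : Fin d → ℝ, ‖act T (phi a) x‖ₑ

/-- The Wiener class. -/
def wiener {d : ℕ} {X : Type*} [NormedAddCommGroup X] [NormedSpace ℂ X]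
    (T : (Fin d → ℝ) → X →L[ℂ] X) : Set X :=
  {x | wienerNorm T x < ∞}

/-- The norm `∑_{k ∈ ℤ^d} max_{|n|_∞ ≥ |k|_∞} ‖phi n · x‖`, with value `∞` off the
Beurling class.  The norm on `Fin d → ℤ` is `|k|_∞ = max_j |k_j|`. -/
def beurlingNorm {d : ℕ} {X : Type*} [NormedAddCommGroup X] [NormedSpace ℂ X]
    (T : (Fin d → ℝ) → X →L[ℂ] X) (x : X) : ℝ≥0∞ :=
  ∑' k : Fin d → ℤ, ⨆ n : {n : Fin d → ℤ // ‖k‖ ≤ ‖n‖},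
    ‖act T (phi fun j => ((n : Fin d → ℤ) j : ℝ)) x‖ₑ

/-- The Beurling class. -/
def beurling {d : ℕ} {X : Type*} [NormedAddCommGroup X] [NormedSpace ℂ X]
    (T : (Fin d → ℝ) → X →L[ℂ] X) : Set X :=
  {x | beurlingNorm T x < ∞}

/-- The graph of the operator `A_k`, where `i A_k` is the infinitesimal generator of the
one-parameter group `t ↦ T (0, …, 0, t, 0, …, 0)` (`t` in place `k`):
`x ∈ D(A_k)` and `A_k x = y`. -/
def GenGraph {d : ℕ} {X : Type*} [NormedAddCommGroup X] [NormedSpace ℂ X]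
    (T : (Fin d → ℝ) → X →L[ℂ] X) (k : Fin d) (x y : X) : Prop :=
  HasDerivAt (fun t : ℝ => T (Pi.single k t) x) (Complex.I • y) 0

/-- The graph of the composition `A_{k₁} A_{k₂} ⋯ A_{kᵣ}` (on its natural domain) along the list
`[k₁, …, kᵣ]`; the last operator is applied first. -/
def WordGraph {d : ℕ} {X : Type*} [NormedAddCommGroup X] [NormedSpace ℂ X]
    (T : (Fin d → ℝ) → X →L[ℂ] X) : List (Fin d) → X → X → Prop
  | [], x, y => y = x
  | k :: w, x, y => ∃ z, WordGraph T w x z ∧ GenGraph T k z y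

/-- The graph of `A^α = A_1^{α_1} ⋯ A_d^{α_d}`: `x ∈ D(A^α)` and `A^α x = y`. -/
def PowGraph {d : ℕ} {X : Type*} [NormedAddCommGroup X] [NormedSpace ℂ X]
    (T : (Fin d → ℝ) → X →L[ℂ] X) (α : Fin d → ℕ) (x y : X) : Prop :=
  WordGraph T ((List.finRange d).flatMap fun k => List.replicate (α k) k) x y

/-- The Sobolev-type class over a class `F`: all `x` such that `x ∈ D(A^α)` and `A^α x ∈ F`
for all multi-indices `α` with `|α| = α_1 + ⋯ + α_d ≤ m`. -/
def sobolev {d : ℕ} {X : Type*} [NormedAddCommGroup X] [NormedSpace ℂ X]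
    (T : (Fin d → ℝ) → X →L[ℂ] X) (F : Set X) (m : ℕ) : Set X :=
  {x | ∀ α : Fin d → ℕ, ∑ k, α k ≤ m → ∃ y, PowGraph T α x y ∧ y ∈ F}

/-- The Sobolev-Wiener class `W^(m)`. -/
def sobolevWiener {d : ℕ} {X : Type*} [NormedAddCommGroup X] [NormedSpace ℂ X]
    (T : (Fin d → ℝ) → X →L[ℂ] X) (m : ℕ) : Set X :=
  sobolev T (wiener T) m

/-- The Sobolev-Beurling class `B^(m)`. -/
def sobolevBeurling {d : ℕ} {X : Type*} [NormedAddCommGroup X] [NormedSpace ℂ X]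
    (T : (Fin d → ℝ) → X →L[ℂ] X) (m : ℕ) : Set X :=
  sobolev T (beurling T) m

/-- `S` is a unital subalgebra of `B` that contains the inverse in `B` of each of its elements
that is invertible in `B`. -/
def IsInverseClosedSubalgebra {B : Type*} [Ring B] [Algebra ℂ B] (S : Set B) : Prop :=
  (∃ A : Subalgebra ℂ B, (A : Set B) = S) ∧
    ∀ u : Bˣ, (u : B) ∈ S → ((u⁻¹ : Bˣ) : B) ∈ S

end

end SpectralDecay

open MeasureTheory
open scoped ENNReal

namespace SpectralDecay

noncomputable section

/-! ### The Fejér kernel on the line: Fourier inversion, supports, dilation. -/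

section FejerKernel

open Complex FourierTransform

/-! The contractions `x ↦ φ_n x`, `n ∈ ℤ^d`, cut `x` into pieces with spectrum in the cube of radius
1 about `n`. Since `T` acts by automorphisms, spectra add under multiplication: `φ_c (φ_m x · φ_n
y)` vanishes unless all entries of `c - m - n` are at most 2 in absolute value (`cell_mul_eq_zero`).
So the coefficient norms of a product are dominated by a discrete convolution (`coeff_mul_le`). This
makes the discrete Wiener norm `wnorm` submultiplicative up to a constant and gives the mixed
estimate `bnorm (x y) ≤ C (bnorm x · wnorm y + wnorm x · bnorm y)` (`bnorm_mul_le`).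

Elements of bounded spectrum are dense, so it suffices to invert `1 - z` with `‖z‖ < 1` inside the
class (`inv_mem_of_dense`). For the Wiener class the Neumann series converges in an equivalent norm
(`exists_tsum_wnorm_pow_lt_top`). Write `z = y + e` with `y` a low-frequency truncation at scale
`N`. Counted in cells of size `N`, the spectrum of `y^k` fills at most `(8k+1)^d` cells, so the
norms of the `y^k` are summable with a bound independent of `N`, while the norm of `e` tends to 0.
Telescoping `z^n - y^n` gives a convolution inequality whose small coefficient is absorbed. For the
Beurling class, some power `z^q` then has small Wiener norm, the mixed estimate gives geometric
decay of `bnorm` along the powers of `z^q`, and `(1 - z)⁻¹ = (∑_{i<q} z^i) (1 - z^q)⁻¹`.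

The integral and the discrete Wiener norms are finite together, by averaging over translates of the
lattice. The Sobolev order is then formal: the generators are commuting derivations with `A(u⁻¹) =
-u⁻¹ (A u) u⁻¹`, and induction on the order passes from any inverse-closed subalgebra to its Sobolev
class (`isInverseClosedSubalgebra_sobolev`). -/

theorem triangle_nonneg (l : ℝ) : 0 ≤ triangle l := le_max_right _ _

theorem triangle_le_one (l : ℝ) : triangle l ≤ 1 :=
  max_le (by linarith [abs_nonneg l]) zero_le_one

theorem continuous_triangle : Continuous triangle := by
  unfold triangle; fun_prop

theorem triangle_eq_zero {l : ℝ} (h : 1 ≤ |l|) : triangle l = 0 :=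
  max_eq_right (by linarith)

theorem triangle_eq {l : ℝ} (h : |l| ≤ 1) : triangle l = 1 - |l| :=
  max_eq_left (by linarith)

theorem integrable_triangle : Integrable triangle := by
  apply continuous_triangle.integrable_of_hasCompactSupport
  refine HasCompactSupport.intro (isCompact_Icc (a := (-1 : ℝ)) (b := 1)) fun x hx => ?_
  apply triangle_eq_zero
  by_contra! h
  exact hx ⟨(abs_lt.1 h).1.le, (abs_lt.1 h).2.le⟩

/-- The inverse Fourier transform of a translate of the triangle function. -/
def ker (a s : ℝ) : ℂ :=
  (2 * Real.pi : ℂ)⁻¹ * ∫ l : ℝ, (triangle (l - a) : ℂ) * cexp (I * ((s * l : ℝ) : ℂ))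

/-- The Fejér kernel of the real line. -/
def fejer (s : ℝ) : ℝ := (2 * Real.pi)⁻¹ * ∫ l : ℝ, triangle l * Real.cos (s * l)

theorem norm_cexp_I_mul (t : ℝ) : ‖cexp (I * (t : ℂ))‖ = 1 := by
  rw [mul_comm]; exact norm_exp_ofReal_mul_I t

theorem integrable_triangle_mul_cexp (a s : ℝ) :
    Integrable fun l : ℝ => (triangle (l - a) : ℂ) * cexp (I * ((s * l : ℝ) : ℂ)) := by
  refine ((integrable_triangle.comp_sub_right a).ofReal (𝕜 := ℂ)).mul_bdd (c := 1) ?_ ?_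
  · exact Continuous.aestronglyMeasurable (by fun_prop)
  · exact .of_forall fun l => (norm_cexp_I_mul _).le

theorem ker_eq_mul (a s : ℝ) : ker a s = cexp (I * ((a * s : ℝ) : ℂ)) * ker 0 s := by
  unfold ker
  rw [← integral_add_right_eq_self _ a, mul_left_comm,
    ← integral_const_mul (cexp _)]
  congr 1
  refine integral_congr_ae (.of_forall fun l => ?_)
  beta_reduce
  rw [add_sub_cancel_right, sub_zero, mul_left_comm, ← Complex.exp_add]
  congr 2
  push_cast; ring

theorem ker_zero (s : ℝ) : ker 0 s = (fejer s : ℂ) := by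
  have hconj : (starRingEnd ℂ) (ker 0 s) = ker 0 s := by
    unfold ker
    rw [map_mul, ← integral_conj, ← integral_neg_eq_self]
    congr 1
    · rw [map_inv₀, map_mul, Complex.conj_ofReal, Complex.conj_ofNat]
    · congr 1
      ext l
      rw [map_mul, ← Complex.exp_conj]
      simp [triangle]
  rw [← Complex.conj_eq_iff_re.1 hconj]
  congr 1
  unfold ker fejer
  have : (2 * Real.pi : ℂ)⁻¹ = (((2 * Real.pi)⁻¹ : ℝ) : ℂ) := by push_cast; rfl
  rw [this, Complex.re_ofReal_mul]
  congr 1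
  have h := integral_re (integrable_triangle_mul_cexp 0 s)
  simp only [RCLike.re_to_complex] at h
  rw [← h]
  congr 1
  ext l
  rw [Complex.re_ofReal_mul, mul_comm I, Complex.exp_ofReal_mul_I_re, sub_zero]

/-- The closed form shows both positivity and quadratic decay, the two facts needed about the
kernel. -/
theorem fejer_eq {s : ℝ} (hs : s ≠ 0) : fejer s = (1 - Real.cos s) / (Real.pi * s ^ 2) := by
  have h1 : ∀ l : ℝ, triangle l * Real.cos (s * l)
      = (fun x : ℝ => triangle x * Real.cos (s * x)) |l| := by
    intro l
    rcases abs_cases l with h | h <;> simp [h.1, triangle]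
  have h2 : ∫ l in Set.Ioi (0 : ℝ), triangle l * Real.cos (s * l)
      = ∫ l in (0 : ℝ)..1, (1 - l) * Real.cos (s * l) := by
    rw [intervalIntegral.integral_of_le zero_le_one, ← Set.Ioc_union_Ioi_eq_Ioi zero_le_one]
    rw [setIntegral_eq_of_subset_of_forall_sdiff_eq_zero (s := Set.Ioc (0 : ℝ) 1)]
    · refine setIntegral_congr_fun measurableSet_Ioc fun l hl => ?_
      rw [triangle_eq (abs_le.2 ⟨by linarith [hl.1], hl.2⟩), abs_of_pos hl.1]
    · measurability
    · exact Set.subset_union_left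
    · rintro l ⟨hl, hl'⟩
      have : 1 < l := by
        rcases hl with hl | hl
        · exact absurd hl hl'
        · exact hl
      rw [triangle_eq_zero (by rw [abs_of_pos (by linarith)]; exact this.le), zero_mul]
  have h3 : ∫ l in (0 : ℝ)..1, (1 - l) * Real.cos (s * l) = (1 - Real.cos s) / s ^ 2 := by
    have hd : ∀ l ∈ Set.uIcc (0 : ℝ) 1, HasDerivAt
        (fun l : ℝ => (1 - l) * Real.sin (s * l) / s - Real.cos (s * l) / s ^ 2)
        ((1 - l) * Real.cos (s * l)) l := by
      intro l _
      have e1 : HasDerivAt (fun l : ℝ => s * l) s l := by simpa using (hasDerivAt_id l).const_mul s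
      have e2 : HasDerivAt (fun l : ℝ => 1 - l) (-1) l := by
        simpa using (hasDerivAt_id l).const_sub 1
      have := ((e2.mul e1.sin).div_const s).sub (e1.cos.div_const (s ^ 2))
      refine this.congr_deriv ?_
      field_simp
      ring
    rw [intervalIntegral.integral_eq_sub_of_hasDerivAt hd]
    · simp [sub_div, neg_add_eq_sub]
    · exact Continuous.intervalIntegrable (by fun_prop) _ _
  rw [fejer, integral_congr_ae (.of_forall h1),
    integral_comp_abs (f := fun x : ℝ => triangle x * Real.cos (s * x)), h2, h3]
  have := Real.pi_pos.ne'
  field_simp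

theorem fejer_nonneg (s : ℝ) : 0 ≤ fejer s := by
  rcases eq_or_ne s 0 with rfl | hs
  · simp only [fejer, zero_mul, Real.cos_zero, mul_one]
    exact mul_nonneg (by positivity) (integral_nonneg fun l => triangle_nonneg l)
  · rw [fejer_eq hs]
    exact div_nonneg (by linarith [Real.cos_le_one s]) (by positivity)

theorem continuous_ker (a : ℝ) : Continuous (ker a) := by
  unfold ker
  refine continuous_const.mul (continuous_of_dominated (bound := fun l => triangle (l - a))
    (fun s => (integrable_triangle_mul_cexp a s).aestronglyMeasurable) ?_
    (integrable_triangle.comp_sub_right a) ?_)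
  · intro s
    refine .of_forall fun l => ?_
    rw [norm_mul, norm_cexp_I_mul, mul_one, Complex.norm_real, Real.norm_of_nonneg
      (triangle_nonneg _)]
  · exact .of_forall fun l => by fun_prop

theorem integrable_ker_zero : Integrable (ker 0) := by
  refine Integrable.mono' (integrable_inv_one_add_sq.const_mul 5)
    (continuous_ker 0).aestronglyMeasurable ?_
  filter_upwards [compl_mem_ae_iff.2 (measure_singleton (0 : ℝ))] with s hs
  have hs : s ≠ 0 := hs
  rw [ker_zero, Complex.norm_real, Real.norm_of_nonneg (fejer_nonneg s), fejer_eq hs,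
    ← div_eq_mul_inv, div_le_div_iff₀ (by positivity) (by positivity)]
  -- `1 - cos s` is at most `s²/2` and at most 2, so its product with `1 + s²` is at most `(5/2)
  -- s²`; the constant 5 is generous.
  have h1 := Real.one_sub_sq_div_two_le_cos (x := s)
  have h2 := Real.neg_one_le_cos s
  have h3 := Real.pi_gt_three
  have h4 : 0 < s ^ 2 := by positivity
  nlinarith

theorem norm_ker (a s : ℝ) : ‖ker a s‖ = fejer s := by
  rw [ker_eq_mul, norm_mul, norm_cexp_I_mul, one_mul, ker_zero, Complex.norm_real,
    Real.norm_of_nonneg (fejer_nonneg s)]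

theorem integrable_ker (a : ℝ) : Integrable (ker a) :=
  integrable_ker_zero.mono (continuous_ker a).aestronglyMeasurable
    (.of_forall fun s => by rw [norm_ker, norm_ker])

/-- Fourier inversion, available because the kernel is integrable; the substitution `s ↦ -2π s`
converts between the two normalizations of the transform. -/
theorem integral_ker_zero_mul_cexp (u : ℝ) :
    ∫ s : ℝ, ker 0 s * cexp (-I * ((u * s : ℝ) : ℂ)) = triangle u := by
  have hpi : (2 * Real.pi : ℝ) ≠ 0 := by positivity
  have hF : ∀ w : ℝ, 𝓕 (fun l : ℝ => (triangle l : ℂ)) w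
      = (2 * Real.pi : ℂ) * ker 0 (-(2 * Real.pi) * w) := by
    intro w
    rw [Real.fourier_real_eq_integral_exp_smul, ker, ← mul_assoc, mul_inv_cancel₀ (by
      exact_mod_cast hpi), one_mul]
    congr 1
    ext l
    rw [smul_eq_mul, mul_comm, sub_zero, mul_comm I]
    congr 4
    ring
  have hint : Integrable (𝓕 (fun l : ℝ => (triangle l : ℂ))) := by
    rw [funext hF]
    exact (integrable_ker_zero.comp_mul_left' (neg_ne_zero.2 hpi)).const_mul _
  have hc : Continuous fun l : ℝ => (triangle l : ℂ) :=
    Complex.continuous_ofReal.comp continuous_triangle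
  have h := congrFun (hc.fourierInv_fourier_eq (integrable_triangle.ofReal (𝕜 := ℂ)) hint) u
  rw [Real.fourierInv_eq', funext hF] at h
  rw [← h]
  have := Measure.integral_comp_mul_left
    (fun s : ℝ => ker 0 s * cexp (-I * ((u * s : ℝ) : ℂ))) (-(2 * Real.pi))
  rw [abs_inv, abs_neg, abs_of_pos (by positivity), eq_inv_smul_iff₀ hpi] at this
  rw [← this, ← integral_smul]
  congr 1
  ext s
  rw [Complex.real_smul, smul_eq_mul]
  simp only [RCLike.inner_apply, conj_trivial]
  push_cast
  rw [show -I * (↑u * (-(2 * ↑Real.pi) * (s : ℂ))) = 2 * Real.pi * (u * s) * I by ring]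
  ring

/-- The Fourier transform of `ker a` is the triangle function centred at `a`. -/
theorem integral_ker_mul_cexp (a u : ℝ) :
    ∫ s : ℝ, ker a s * cexp (-I * ((u * s : ℝ) : ℂ)) = triangle (u - a) := by
  rw [← integral_ker_zero_mul_cexp]
  congr 1
  ext s
  rw [ker_eq_mul, mul_comm (cexp _), mul_assoc, ← Complex.exp_add]
  congr 2
  push_cast; ring

theorem integral_fejer : ∫ s, fejer s = 1 := by
  have h := integral_ker_zero_mul_cexp 0
  simp only [zero_mul, ofReal_zero, mul_zero, Complex.exp_zero, mul_one, ker_zero] at h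
  have h' : (∫ s, fejer s) = triangle 0 := by
    have h2 : ∫ s, (fejer s : ℂ) = ((∫ s, fejer s : ℝ) : ℂ) := integral_ofReal
    rw [h2] at h
    exact_mod_cast h
  rw [h', triangle]; simp

/-- If the Fourier transform of `M` vanishes outside the interval of radius `R` about `c`, then
that of `M · ker b (t - ·)` vanishes outside the interval of radius `R + 1` about `c - b`. -/
theorem integral_mul_ker_sub_mul_cexp_eq_zero {M : ℝ → ℂ} (hM : Integrable M) {c R : ℝ}
    (h : ∀ u : ℝ, R ≤ |u - c| → ∫ g, M g * cexp (-I * ((u * g : ℝ) : ℂ)) = 0)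
    (b t u : ℝ) (hu : R + 1 ≤ |u - (c - b)|) :
    ∫ g, M g * ker b (t - g) * cexp (-I * ((u * g : ℝ) : ℂ)) = 0 := by
  have hswap : ∀ g l : ℝ, M g * cexp (-I * ((u * g : ℝ) : ℂ)) *
      ((triangle (l - b) : ℂ) * cexp (I * (((t - g) * l : ℝ) : ℂ))) =
      ((triangle (l - b) : ℂ) * cexp (I * ((t * l : ℝ) : ℂ))) *
        (M g * cexp (-I * (((u + l) * g : ℝ) : ℂ))) := by
    intro g l
    have : cexp (-I * ((u * g : ℝ) : ℂ)) * cexp (I * (((t - g) * l : ℝ) : ℂ)) =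
        cexp (I * ((t * l : ℝ) : ℂ)) * cexp (-I * (((u + l) * g : ℝ) : ℂ)) := by
      rw [← Complex.exp_add, ← Complex.exp_add]
      congr 1
      push_cast; ring
    linear_combination (M g * (triangle (l - b) : ℂ)) * this
  have hb : Integrable fun l : ℝ => (triangle (l - b) : ℂ) :=
    (integrable_triangle.comp_sub_right b).ofReal
  have key : ∫ g, ∫ l : ℝ, M g * cexp (-I * ((u * g : ℝ) : ℂ)) *
      ((triangle (l - b) : ℂ) * cexp (I * (((t - g) * l : ℝ) : ℂ))) = 0 := by
    rw [integral_integral_swap]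
    · simp_rw [hswap, integral_const_mul]
      refine integral_eq_zero_of_ae (.of_forall fun l => ?_)
      simp only [Pi.zero_apply]
      -- The inner integral is the transform of `M` at `u + l`; for `|l - b| < 1` this point is
      -- still at distance at least `R` from `c`.
      rcases le_or_gt 1 |l - b| with hl | hl
      · simp [triangle_eq_zero hl]
      · rw [h, mul_zero]
        have := abs_sub_abs_le_abs_sub (u - (c - b)) (-(l - b))
        rw [abs_neg] at this
        rw [show u + l - c = u - (c - b) - -(l - b) by ring]
        linarith
    · have h0 : Integrable (fun p : ℝ × ℝ => M p.1 * (triangle (p.2 - b) : ℂ))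
        (volume.prod volume) := hM.mul_prod hb
      refine (h0.mul_bdd (c := 1) (g := fun p : ℝ × ℝ => cexp (-I * ((u * p.1 : ℝ) : ℂ)) *
        cexp (I * (((t - p.1) * p.2 : ℝ) : ℂ))) ?_ ?_).congr ?_
      · exact Continuous.aestronglyMeasurable (by fun_prop)
      · refine .of_forall fun p => ?_
        rw [norm_mul, norm_cexp_I_mul, neg_mul, ← mul_neg, ← Complex.ofReal_neg, norm_cexp_I_mul,
          mul_one]
      · exact .of_forall fun p => by simp only [Function.uncurry]; ring
  rw [← mul_zero (2 * Real.pi : ℂ)⁻¹, ← key, ← integral_const_mul]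
  congr 1
  ext g
  rw [integral_const_mul, ker]
  ring

/-- The transform of `ker c` lives within radius 1 of `c`. Each further factor shifts the centre, by
`-a` and by `-b`, and widens the radius by 1. The integral is the value at frequency 0, outside the
resulting interval of radius 3. -/
theorem integral_ker_mul_ker_mul_ker_eq_zero {a b c : ℝ} (h : 3 ≤ |c - a - b|) (s t : ℝ) :
    ∫ g, ker c g * ker a (s - g) * ker b (t - g) = 0 := by
  obtain ⟨C, hC⟩ : ∃ C, ∀ x, ‖ker a x‖ ≤ C := by
    refine ⟨‖(2 * Real.pi : ℂ)⁻¹‖ * ∫ l, triangle (l - a), fun x => ?_⟩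
    rw [ker, norm_mul]
    gcongr
    refine norm_integral_le_of_norm_le (integrable_triangle.comp_sub_right a)
      (.of_forall fun l => ?_)
    rw [norm_mul, norm_cexp_I_mul, mul_one, Complex.norm_real, Real.norm_of_nonneg
      (triangle_nonneg _)]
  have h1 : ∀ u : ℝ, 1 ≤ |u - c| → ∫ g, ker c g * cexp (-I * ((u * g : ℝ) : ℂ)) = 0 := by
    intro u hu
    rw [integral_ker_mul_cexp, triangle_eq_zero hu, ofReal_zero]
  have hint : Integrable fun g => ker c g * ker a (s - g) :=
    (integrable_ker c).mul_bdd (c := C)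
      ((continuous_ker a).comp (by fun_prop)).aestronglyMeasurable (.of_forall fun g => hC _)
  have h2 := integral_mul_ker_sub_mul_cexp_eq_zero hint
    (integral_mul_ker_sub_mul_cexp_eq_zero (integrable_ker c) h1 a s) b t 0 (by
      rw [zero_sub, abs_neg]; linarith)
  simpa using h2

/-- A piecewise linear function with integer breakpoints equals its linear interpolation from the
integers, and the breakpoints here are `N(n-1)`, `Nn` and `N(n+1)`. -/
theorem sum_triangle_mul_triangle (N : ℕ) (hN : 1 ≤ N) (n : ℤ) (l : ℝ) :
    triangle (l / N - n) =
      ∑ m ∈ Finset.Icc (N * (n - 1)) (N * (n + 1)), triangle (m / N - n) * triangle (l - m) := by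
  have hN0 : (0 : ℝ) < N := by exact_mod_cast hN
  set p : ℤ := ⌊l⌋ with hp
  have hpl : (p : ℝ) ≤ l := Int.floor_le l
  have hlp : l < p + 1 := Int.lt_floor_add_one l
  have hz : ∀ m : ℤ, m ∉ Finset.Icc (N * (n - 1)) (N * (n + 1) : ℤ) →
      triangle (m / N - n) = 0 := by
    intro m hm
    apply triangle_eq_zero
    rw [Finset.mem_Icc, not_and_or, not_le, not_le] at hm
    rcases hm with hm | hm
    · have hm' : (m : ℝ) < N * (n - 1) := by exact_mod_cast hm
      have : (m : ℝ) / N < n - 1 := by rw [div_lt_iff₀ hN0]; linarith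
      rw [abs_of_neg (by linarith)]; linarith
    · have hm' : (N * (n + 1) : ℝ) < m := by exact_mod_cast hm
      have : (n : ℝ) + 1 < m / N := by rw [lt_div_iff₀ hN0]; linarith
      rw [abs_of_pos (by linarith)]; linarith
  have hsum : ∑ m ∈ Finset.Icc (N * (n - 1)) (N * (n + 1) : ℤ),
      triangle (m / N - n) * triangle (l - m) =
      ∑ m ∈ ({p, p + 1} : Finset ℤ), triangle (m / N - n) * triangle (l - m) := by
    classical
    rw [Finset.sum_subset (Finset.subset_union_left (s₂ := ({p, p + 1} : Finset ℤ))),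
      ← Finset.sum_subset (Finset.subset_union_right (s₂ := ({p, p + 1} : Finset ℤ)))]
    · intro m _ hm
      rw [Finset.mem_insert, Finset.mem_singleton, not_or] at hm
      rw [triangle_eq_zero (l := l - m), mul_zero]
      rcases lt_or_gt_of_ne hm.1 with h | h
      · have : (m : ℝ) + 1 ≤ p := by exact_mod_cast h
        rw [abs_of_pos (by linarith)]; linarith
      · have h' : p + 1 < m := by omega
        have : (p : ℝ) + 1 + 1 ≤ m := by exact_mod_cast h'
        rw [abs_of_neg (by linarith)]; linarith
    · intro m _ hm
      rw [hz m hm, zero_mul]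
  rw [hsum, Finset.sum_pair (by simp)]
  push_cast
  rw [triangle_eq (l := l - p) (by rw [abs_of_nonneg] <;> linarith),
    triangle_eq (l := l - (p + 1)) (by rw [abs_of_nonpos] <;> linarith),
    abs_of_nonneg (by linarith : 0 ≤ l - p), abs_of_nonpos (by linarith : l - (p + 1) ≤ 0)]
  -- No breakpoint lies strictly between `p` and `p + 1`, so this interval sits in one of the four
  -- linear pieces.
  have hcase : (p + 1 ≤ N * (n - 1) ∨ (N * (n - 1) ≤ p ∧ p + 1 ≤ N * n)) ∨
      ((N * n ≤ p ∧ p + 1 ≤ N * (n + 1)) ∨ N * (n + 1) ≤ p) := by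
    have e1 : (N * (n - 1) : ℤ) = N * n - N := by ring
    have e2 : (N * (n + 1) : ℤ) = N * n + N := by ring
    omega
  have eqz1 : ∀ x : ℝ, x ≤ N * (n - 1) → triangle (x / N - n) = 0 := by
    intro x h
    have : x / N ≤ n - 1 := by rw [div_le_iff₀ hN0]; linarith
    apply triangle_eq_zero
    rw [abs_of_neg (by linarith)]; linarith
  have eqz2 : ∀ x : ℝ, N * (n + 1) ≤ x → triangle (x / N - n) = 0 := by
    intro x h
    have : (n + 1 : ℝ) ≤ x / N := by rw [le_div_iff₀ hN0]; linarith
    apply triangle_eq_zero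
    rw [abs_of_pos (by linarith)]; linarith
  have eq1 : ∀ x : ℝ, N * (n - 1) ≤ x → x ≤ N * n → triangle (x / N - n) = 1 + (x / N - n) := by
    intro x h h'
    have h1 : (n - 1 : ℝ) ≤ x / N := by rw [le_div_iff₀ hN0]; linarith
    have h2 : x / N ≤ n := by rw [div_le_iff₀ hN0]; linarith
    rw [triangle_eq, abs_of_nonpos (by linarith)]
    · ring
    · rw [abs_of_nonpos (by linarith)]; linarith
  have eq2 : ∀ x : ℝ, N * n ≤ x → x ≤ N * (n + 1) → triangle (x / N - n) = 1 - (x / N - n) := by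
    intro x h h'
    have h1 : (n : ℝ) ≤ x / N := by rw [le_div_iff₀ hN0]; linarith
    have h2 : x / N ≤ n + 1 := by rw [div_le_iff₀ hN0]; linarith
    rw [triangle_eq, abs_of_nonneg (by linarith)]
    rw [abs_of_nonneg (by linarith)]; linarith
  rcases hcase with (h | ⟨h, h'⟩) | (⟨h, h'⟩ | h)
  · have h : (p + 1 : ℝ) ≤ N * (n - 1) := by exact_mod_cast h
    rw [eqz1 _ h, eqz1 l (by linarith), eqz1 p (by linarith)]; ring
  · have h : (N * (n - 1) : ℝ) ≤ p := by exact_mod_cast h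
    have h' : (p + 1 : ℝ) ≤ N * n := by exact_mod_cast h'
    rw [eq1 l, eq1 p, eq1 (p + 1)] <;> first | linarith | skip
    field_simp; ring
  · have h : (N * n : ℝ) ≤ p := by exact_mod_cast h
    have h' : (p + 1 : ℝ) ≤ N * (n + 1) := by exact_mod_cast h'
    rw [eq2 l, eq2 p, eq2 (p + 1)] <;> first | linarith | skip
    field_simp; ring
  · have h : (N * (n + 1) : ℝ) ≤ p := by exact_mod_cast h
    rw [eqz2 _ h, eqz2 l (by linarith), eqz2 (p + 1) (by linarith)]; ring

/-- A dilated Fejér kernel is a finite combination of modulated Fejér kernels. -/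
theorem mul_ker_mul (N : ℕ) (hN : 1 ≤ N) (n : ℤ) (s : ℝ) :
    N * ker n (N * s) =
      ∑ m ∈ Finset.Icc (N * (n - 1)) (N * (n + 1)), (triangle (m / N - n) : ℂ) * ker m s := by
  have hN0 : (0 : ℝ) < N := by exact_mod_cast hN
  have h1 : (N : ℂ) * ∫ l : ℝ, (triangle (l - n) : ℂ) * cexp (I * ((N * s * l : ℝ) : ℂ)) =
      ∫ l : ℝ, (triangle (l / N - n) : ℂ) * cexp (I * ((s * l : ℝ) : ℂ)) := by
    have := Measure.integral_comp_div
      (fun l : ℝ => (triangle (l - n) : ℂ) * cexp (I * ((N * s * l : ℝ) : ℂ))) (N : ℝ)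
    rw [abs_of_pos hN0, Complex.real_smul] at this
    rw [Complex.ofReal_natCast] at this
    rw [← this]
    congr 1
    ext l
    congr 4
    field_simp
  unfold ker
  rw [mul_left_comm, h1]
  have h2 : ∀ l : ℝ, (triangle (l / N - n) : ℂ) * cexp (I * ((s * l : ℝ) : ℂ)) =
      ∑ m ∈ Finset.Icc (N * (n - 1)) (N * (n + 1) : ℤ),
        (triangle (m / N - n) : ℂ) * ((triangle (l - m) : ℂ) * cexp (I * ((s * l : ℝ) : ℂ))) := by
    intro l
    rw [sum_triangle_mul_triangle N hN n]
    push_cast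
    rw [Finset.sum_mul]
    simp_rw [mul_assoc]
  rw [integral_congr_ae (.of_forall h2), integral_finsetSum]
  · rw [Finset.mul_sum]
    refine Finset.sum_congr rfl fun m _ => ?_
    rw [integral_const_mul]
    ring
  · intro m _
    exact (integrable_triangle_mul_cexp m s).const_mul _

end FejerKernel

/-! ### The spectral pieces of an element: decomposition, dilation, spectra of products. -/

section Cells

open Complex Filter Topology

variable {d : ℕ}

theorem phi_eq_prod (a s : Fin d → ℝ) : phi a s = ∏ k, ker (a k) (s k) := by
  simp only [phi, ker, phiHat, Finset.prod_mul_distrib, Finset.prod_const, Finset.card_univ,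
    Fintype.card_fin, inv_pow]
  rw [← integral_fintype_prod_volume_eq_prod (f := fun (k : Fin d) (l : ℝ) =>
    (triangle (l - a k) : ℂ) * cexp (I * ((s k * l : ℝ) : ℂ)))]
  congr 1
  refine integral_congr_ae (.of_forall fun l => ?_)
  beta_reduce
  rw [Finset.prod_mul_distrib, ← Complex.exp_sum, Complex.ofReal_prod, Complex.ofReal_sum,
    Finset.mul_sum]

theorem continuous_phi (a : Fin d → ℝ) : Continuous (phi a) := by
  rw [funext (phi_eq_prod a)]
  exact continuous_finsetProd _ fun k _ => (continuous_ker _).comp (continuous_apply k)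

theorem integrable_phi (a : Fin d → ℝ) : Integrable (phi a) := by
  rw [funext (phi_eq_prod a)]
  exact Integrable.fintype_prod fun k => integrable_ker (a k)

theorem norm_phi (a s : Fin d → ℝ) : ‖phi a s‖ = ∏ k, fejer (s k) := by
  rw [phi_eq_prod, norm_prod]
  exact Finset.prod_congr rfl fun k _ => norm_ker _ _

/-- Modulation leaves the modulus equal to the nonnegative product Fejér kernel, whose mass is 1.
Hence every cell is a contraction. -/
theorem integral_norm_phi (a : Fin d → ℝ) : ∫ s, ‖phi a s‖ = 1 := by
  simp_rw [norm_phi]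
  rw [integral_fintype_prod_volume_eq_prod (f := fun _ => fejer)]
  simp [integral_fejer]

theorem integral_phi (a : Fin d → ℝ) : ∫ s, phi a s = ∏ k, (triangle (a k) : ℂ) := by
  rw [funext (phi_eq_prod a), integral_fintype_prod_volume_eq_prod (f := fun k => ker (a k))]
  refine Finset.prod_congr rfl fun k _ => ?_
  have := integral_ker_mul_cexp (a k) 0
  simp only [zero_mul, ofReal_zero, mul_zero, Complex.exp_zero, mul_one, zero_sub] at this
  rw [this]
  simp [triangle]

theorem phi_add (a b s : Fin d → ℝ) :
    phi (a + b) s = cexp (I * ((∑ k, b k * s k : ℝ) : ℂ)) * phi a s := by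
  rw [phi_eq_prod, phi_eq_prod, Complex.ofReal_sum, Finset.mul_sum, Complex.exp_sum,
    ← Finset.prod_mul_distrib]
  refine Finset.prod_congr rfl fun k _ => ?_
  rw [ker_eq_mul, ker_eq_mul (a k), ← mul_assoc, ← Complex.exp_add]
  congr 2
  simp only [Pi.add_apply]
  push_cast
  ring

theorem integral_phi_mul_phi_mul_phi_eq_zero {a b c : Fin d → ℝ} {k : Fin d}
    (h : 3 ≤ |c k - a k - b k|) (s t : Fin d → ℝ) :
    ∫ g, phi c g * phi a (s - g) * phi b (t - g) = 0 := by
  simp_rw [phi_eq_prod, ← Finset.prod_mul_distrib, Pi.sub_apply]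
  rw [integral_fintype_prod_volume_eq_prod (f := fun k (g : ℝ) =>
    ker (c k) g * ker (a k) (s k - g) * ker (b k) (t k - g))]
  exact Finset.prod_eq_zero (Finset.mem_univ k) (integral_ker_mul_ker_mul_ker_eq_zero h _ _)

section Rep

variable {X : Type*} [NormedAddCommGroup X] [NormedSpace ℂ X] {T : (Fin d → ℝ) → X →L[ℂ] X}

theorem IsIsometricRep.integrable_smul (hT : IsIsometricRep T) {f : (Fin d → ℝ) → ℂ}
    (hf : Integrable f) (x : X) : Integrable fun g => f g • T (-g) x := by
  refine (hf.norm.mul_const ‖x‖).mono' ?_ ?_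
  · exact hf.aestronglyMeasurable.smul
      ((hT.continuous x).comp continuous_neg).aestronglyMeasurable
  · exact .of_forall fun g => by rw [norm_smul, hT.norm_map]

theorem norm_act_phi_le (hT : IsIsometricRep T) (a : Fin d → ℝ) (x : X) :
    ‖act T (phi a) x‖ ≤ ‖x‖ := by
  refine (norm_integral_le_integral_norm _).trans ?_
  simp_rw [norm_smul, hT.norm_map]
  rw [integral_mul_const, integral_norm_phi, one_mul]

theorem continuous_act_phi (hT : IsIsometricRep T) (x : X) :
    Continuous fun a => act T (phi a) x := by
  refine continuous_of_dominated (bound := fun g => ‖phi 0 g‖ * ‖x‖) (fun a =>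
    (hT.integrable_smul (integrable_phi a) x).aestronglyMeasurable) ?_
    ((integrable_phi 0).norm.mul_const _) ?_
  · exact fun a => .of_forall fun g => by
      rw [norm_smul, hT.norm_map, norm_phi, norm_phi]
  · refine .of_forall fun g => Continuous.smul ?_ continuous_const
    have : (fun a => phi a g) = fun a => cexp (I * ((∑ k, a k * g k : ℝ) : ℂ)) * phi 0 g := by
      ext a
      rw [← phi_add, zero_add]
    rw [this]
    fun_prop

/-- The operator `x ↦ phi a · x`. -/
def cell (hT : IsIsometricRep T) (a : Fin d → ℝ) : X →L[ℂ] X :=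
  LinearMap.mkContinuous
    { toFun := act T (phi a)
      map_add' := fun x y => by
        simp only [act, map_add, smul_add]
        exact integral_add (hT.integrable_smul (integrable_phi a) x)
          (hT.integrable_smul (integrable_phi a) y)
      map_smul' := fun c x => by
        simp only [act, map_smul, RingHom.id_apply, smul_comm _ c]
        exact integral_smul _ _ } 1 fun x => by
      rw [one_mul]; exact norm_act_phi_le hT a x

theorem cell_apply (hT : IsIsometricRep T) (a : Fin d → ℝ) (x : X) :
    cell hT a x = act T (phi a) x := rfl

theorem enorm_cell_le (hT : IsIsometricRep T) (a : Fin d → ℝ) (x : X) :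
    ‖cell hT a x‖ₑ ≤ ‖x‖ₑ :=
  enorm_le_iff_norm_le.2 (norm_act_phi_le hT a x)

/-- The representation `t ↦ T (t / N)`. -/
def dilate (N : ℕ) (T : (Fin d → ℝ) → X →L[ℂ] X) : (Fin d → ℝ) → X →L[ℂ] X :=
  fun t => T ((N : ℝ)⁻¹ • t)

theorem IsIsometricRep.dilate (hT : IsIsometricRep T) (N : ℕ) :
    IsIsometricRep (dilate N T) where
  map_zero := by rw [SpectralDecay.dilate, smul_zero, hT.map_zero]
  map_add s t := by simp only [SpectralDecay.dilate, smul_add, hT.map_add]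
  norm_map t x := hT.norm_map _ _
  continuous x := (hT.continuous x).comp (continuous_const_smul _)

/-- The representation `t ↦ e^{-i θ·t} T t`. -/
def twist (θ : Fin d → ℝ) (T : (Fin d → ℝ) → X →L[ℂ] X) : (Fin d → ℝ) → X →L[ℂ] X :=
  fun t => cexp (I * ((∑ k, θ k * (-t) k : ℝ) : ℂ)) • T t

theorem IsIsometricRep.twist (hT : IsIsometricRep T) (θ : Fin d → ℝ) :
    IsIsometricRep (twist θ T) where
  map_zero := by simp [SpectralDecay.twist, hT.map_zero]
  map_add s t := by
    ext x
    simp only [SpectralDecay.twist, hT.map_add, _root_.smul_apply,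
      ContinuousLinearMap.comp_apply, map_smul, smul_smul, ← Complex.exp_add]
    congr 2
    simp only [Pi.neg_apply, Pi.add_apply, mul_neg, mul_add, Finset.sum_neg_distrib,
      Finset.sum_add_distrib]
    push_cast
    ring
  norm_map t x := by
    rw [SpectralDecay.twist, _root_.smul_apply, norm_smul, norm_cexp_I_mul, one_mul,
      hT.norm_map]
  continuous x := by
    simp only [SpectralDecay.twist, _root_.smul_apply]
    exact Continuous.smul (by fun_prop) (hT.continuous x)

/-- A character translates the spectrum, so the lattice decomposition holds along every translate of
`ℤ^d`. A twist is in general not multiplicative, hence the decomposition is developed for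
representations on a normed space. -/
theorem cell_twist (hT : IsIsometricRep T) (θ a : Fin d → ℝ) (x : X) :
    cell (hT.twist θ) a x = cell hT (a + θ) x := by
  simp only [cell_apply, act, twist, phi_add, neg_neg, _root_.smul_apply, smul_smul]
  simp_rw [mul_comm (phi a _)]

/-- The point of the integer lattice as a point of `ℝ^d`. -/
def toReal (n : Fin d → ℤ) : Fin d → ℝ := fun j => (n j : ℝ)

theorem smul_phi_smul (N : ℕ) (hN : 1 ≤ N) (n : Fin d → ℤ) (s : Fin d → ℝ) :
    (N : ℂ) ^ d * phi (toReal n) ((N : ℝ) • s) =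
      ∑ m ∈ Fintype.piFinset fun k => Finset.Icc (N * (n k - 1)) (N * (n k + 1) : ℤ),
        ((∏ k, triangle (m k / N - n k) : ℝ) : ℂ) * phi (toReal m) s := by
  have : (N : ℂ) ^ d = ∏ _k : Fin d, (N : ℂ) := by simp
  rw [phi_eq_prod, this, ← Finset.prod_mul_distrib]
  simp only [Pi.smul_apply, smul_eq_mul, toReal, mul_ker_mul N hN]
  rw [Finset.prod_univ_sum]
  refine Finset.sum_congr rfl fun m _ => ?_
  rw [Finset.prod_mul_distrib, phi_eq_prod, Complex.ofReal_prod]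
  rfl

/-- The substitution `g ↦ N g` moves the dilation from the representation to the kernel, and the
dilated kernel is a finite combination of unit ones. So a coarse cell is a finite combination of
unit cells. -/
theorem cell_dilate (hT : IsIsometricRep T) (N : ℕ) (hN : 1 ≤ N) (n : Fin d → ℤ) (x : X) :
    cell (hT.dilate N) (toReal n) x =
      ∑ m ∈ Fintype.piFinset fun k => Finset.Icc (N * (n k - 1)) (N * (n k + 1) : ℤ),
        ((∏ k, triangle (m k / N - n k) : ℝ) : ℂ) • cell hT (toReal m) x := by
  have hN0 : (N : ℝ) ≠ 0 := by positivity
  have h := Measure.integral_comp_smul volume (fun g : Fin d → ℝ =>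
    phi (toReal n) g • T (-((N : ℝ)⁻¹ • g)) x) (N : ℝ)
  rw [Module.finrank_fin_fun, abs_inv, abs_of_nonneg (by positivity),
    eq_inv_smul_iff₀ (by positivity)] at h
  simp only [cell_apply, act, dilate, smul_neg]
  rw [← h, ← integral_smul]
  simp_rw [← integral_smul]
  rw [← integral_finsetSum]
  · refine integral_congr_ae (.of_forall fun g => ?_)
    simp only
    rw [inv_smul_smul₀ hN0, ← Complex.coe_smul, smul_smul, Complex.ofReal_pow,
      Complex.ofReal_natCast, smul_phi_smul N hN, Finset.sum_smul]
    simp_rw [smul_smul]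
  · exact fun m _ => (hT.integrable_smul (integrable_phi _) x).smul _

/-- The weight of the cell `m` in the dilated cell at the origin. -/
def weight (N : ℕ) (m : Fin d → ℤ) : ℝ := ∏ k, triangle (m k / N)

theorem weight_nonneg (N : ℕ) (m : Fin d → ℤ) : 0 ≤ weight N m :=
  Finset.prod_nonneg fun _ _ => triangle_nonneg _

theorem weight_le_one (N : ℕ) (m : Fin d → ℤ) : weight N m ≤ 1 :=
  Finset.prod_le_one (fun _ _ => triangle_nonneg _) fun _ _ => triangle_le_one _

theorem tendsto_weight (m : Fin d → ℤ) : Tendsto (fun N => weight N m) atTop (𝓝 1) := by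
  have h : ∀ k : Fin d, Tendsto (fun N : ℕ => triangle (m k / N)) atTop (𝓝 1) := by
    intro k
    have := (continuous_triangle.tendsto 0).comp (tendsto_const_div_atTop_nhds_zero_nat (m k : ℝ))
    have h1 : triangle 0 = 1 := by simp [triangle]
    rwa [h1] at this
  simpa [weight] using tendsto_finsetProd Finset.univ fun k _ => h k

theorem hasSum_weight_smul_cell (hT : IsIsometricRep T) (N : ℕ) (hN : 1 ≤ N) (x : X) :
    HasSum (fun m : Fin d → ℤ => (weight N m : ℂ) • cell hT (toReal m) x)
      (cell (hT.dilate N) 0 x) := by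
  have h0 : (toReal (0 : Fin d → ℤ)) = 0 := by ext; simp [toReal]
  have hN0 : (0 : ℝ) < N := by exact_mod_cast hN
  have := cell_dilate hT N hN 0 x
  rw [h0] at this
  rw [this]
  simp only [Pi.zero_apply, Int.cast_zero, sub_zero]
  refine hasSum_sum_of_ne_finset_zero fun m hm => ?_
  rw [Fintype.mem_piFinset, not_forall] at hm
  obtain ⟨k, hk⟩ := hm
  rw [weight, Finset.prod_eq_zero (Finset.mem_univ k), ofReal_zero, zero_smul]
  apply triangle_eq_zero
  rw [abs_div, abs_of_pos hN0, le_div_iff₀ hN0, one_mul]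
  have : (N : ℤ) ≤ |m k| := by
    rw [Finset.mem_Icc] at hk
    by_contra! h
    rw [abs_lt] at h
    apply hk
    constructor <;> linarith
  exact_mod_cast this

variable [CompleteSpace X]

theorem tendsto_cell_dilate (hT : IsIsometricRep T) (x : X) :
    Tendsto (fun N : ℕ => cell (hT.dilate N) 0 x) atTop (𝓝 x) := by
  have h0 : ∫ g : Fin d → ℝ, phi 0 g • x = x := by
    rw [integral_smul_const, integral_phi]
    simp [triangle]
  nth_rw 2 [← h0]
  refine tendsto_integral_of_dominated_convergence (fun g => ‖phi 0 g‖ * ‖x‖) (fun N =>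
    ((hT.dilate N).integrable_smul (integrable_phi 0) x).aestronglyMeasurable)
    ((integrable_phi 0).norm.mul_const _) ?_ ?_
  · exact fun N => .of_forall fun g => by rw [norm_smul, (hT.dilate N).norm_map]
  · refine .of_forall fun g => Tendsto.const_smul ?_ _
    have h1 : Tendsto (fun N : ℕ => (N : ℝ)⁻¹ • (-g)) atTop (𝓝 ((0 : ℝ) • (-g))) :=
      tendsto_inv_atTop_nhds_zero_nat.smul_const _
    rw [zero_smul] at h1
    have h2 := ((hT.continuous x).tendsto 0).comp h1
    rwa [hT.map_zero] at h2

/-- Fejér summation: the weighted sums tend to `x` because the kernels form an approximate identity,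
and to the unweighted sum by dominated convergence. -/
theorem hasSum_cell (hT : IsIsometricRep T) {x : X}
    (h : Summable fun m : Fin d → ℤ => ‖cell hT (toReal m) x‖) :
    HasSum (fun m : Fin d → ℤ => cell hT (toReal m) x) x := by
  have h1 : Tendsto (fun N : ℕ => ∑' m : Fin d → ℤ, (weight N m : ℂ) • cell hT (toReal m) x) atTop
      (𝓝 (∑' m : Fin d → ℤ, cell hT (toReal m) x)) := by
    refine tendsto_tsum_of_dominated_convergence h (fun m => ?_) (.of_forall fun N m => ?_)
    · have : Tendsto (fun N => (weight N m : ℂ) • cell hT (toReal m) x) atTop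
          (𝓝 (((1 : ℝ) : ℂ) • cell hT (toReal m) x)) :=
        ((Complex.continuous_ofReal.tendsto _).comp (tendsto_weight m)).smul_const _
      simpa using this
    · rw [norm_smul, Complex.norm_real, Real.norm_of_nonneg (weight_nonneg N m)]
      exact mul_le_of_le_one_left (norm_nonneg _) (weight_le_one N m)
  have h2 : Tendsto (fun N : ℕ => ∑' m : Fin d → ℤ, (weight N m : ℂ) • cell hT (toReal m) x) atTop
      (𝓝 x) := by
    refine (tendsto_cell_dilate hT x).congr' ?_
    filter_upwards [eventually_ge_atTop 1] with N hN
    exact (hasSum_weight_smul_cell hT N hN x).tsum_eq.symm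
  have h3 := h.of_norm.hasSum
  rwa [tendsto_nhds_unique h1 h2] at h3

end Rep

section Alg

variable {B : Type*} [NormedRing B] [NormedAlgebra ℂ B] {T : (Fin d → ℝ) → B →L[ℂ] B}

theorem IsIsometricAutRep.dilate (hT : IsIsometricAutRep T) (N : ℕ) :
    IsIsometricAutRep (dilate N T) where
  toIsIsometricRep := hT.toIsIsometricRep.dilate N
  map_mul _ x y := hT.map_mul _ x y

theorem IsIsometricRep.apply_apply_neg {X : Type*} [NormedAddCommGroup X] [NormedSpace ℂ X]
    {T : (Fin d → ℝ) → X →L[ℂ] X} (hT : IsIsometricRep T) (t : Fin d → ℝ) (x : X) :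
    T t (T (-t) x) = x := by
  rw [← ContinuousLinearMap.comp_apply, ← hT.map_add, add_neg_cancel, hT.map_zero]; rfl

theorem IsIsometricAutRep.map_one (hT : IsIsometricAutRep T) (t : Fin d → ℝ) : T t 1 = 1 := by
  have h := hT.map_mul t 1 (T (-t) 1)
  rwa [one_mul, hT.apply_apply_neg, mul_one, eq_comm] at h

theorem cell_one [CompleteSpace B] (hT : IsIsometricAutRep T) (a : Fin d → ℝ) :
    cell hT.toIsIsometricRep a 1 = (∏ k, (triangle (a k) : ℂ)) • (1 : B) := by
  simp only [cell_apply, act, hT.map_one]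
  rw [integral_smul_const, integral_phi]

/-- Fubini, in a form that respects the order of noncommuting factors; it is applied once for each
factor of a product of two cells. -/
theorem integral_integral_sub_smul_mul [CompleteSpace B] {k : (Fin d → ℝ) → B} (hk : Integrable k)
    {f : (Fin d → ℝ) → ℂ} (hf : Integrable f) {Y : (Fin d → ℝ) → B} (hY : Continuous Y) {C : ℝ}
    (hC : ∀ t, ‖Y t‖ ≤ C) :
    ∫ g, (∫ t, f (t - g) • Y t) * k g = ∫ t, Y t * ∫ g, f (t - g) • k g := by
  have hC0 : 0 ≤ C := (norm_nonneg _).trans (hC 0)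
  have hY' : ∀ g, Integrable fun t => f (t - g) • Y t := fun g => by
    refine ((hf.comp_sub_right g).norm.mul_const C).mono'
      ((hf.comp_sub_right g).aestronglyMeasurable.smul hY.aestronglyMeasurable) ?_
    exact .of_forall fun t => by
      rw [norm_smul]
      exact mul_le_mul_of_nonneg_left (hC t) (norm_nonneg _)
  have hconv := hk.convolution_integrand (μ := volume) ((ContinuousLinearMap.lsmul ℂ ℂ).flip) hf
  have hint : Integrable (fun p : (Fin d → ℝ) × (Fin d → ℝ) => Y p.1 * (f (p.1 - p.2) • k p.2))
      (volume.prod volume) := by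
    refine (hconv.norm.const_mul C).mono' ?_ ?_
    · exact (hY.comp continuous_fst).aestronglyMeasurable.mul hconv.aestronglyMeasurable
    · refine .of_forall fun p => (norm_mul_le _ _).trans ?_
      exact mul_le_mul_of_nonneg_right (hC _) (norm_nonneg _)
  have hfib : ∀ t, Integrable (fun g => f (t - g) • k g) →
      ∫ g, Y t * (f (t - g) • k g) = Y t * ∫ g, f (t - g) • k g := fun t ht =>
    integral_const_mul_of_integrable ht
  have hae : ∀ᵐ t, Integrable (fun g => f (t - g) • k g) := hconv.prod_right_ae
  rw [← integral_congr_ae (hae.mono hfib), integral_integral_swap hint]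
  refine integral_congr_ae (.of_forall fun g => ?_)
  beta_reduce
  rw [← integral_mul_const_of_integrable (hY' g)]
  simp_rw [smul_mul_assoc, mul_smul_comm]

theorem IsIsometricRep.map_act_phi {X : Type*} [NormedAddCommGroup X] [NormedSpace ℂ X]
    [CompleteSpace X] {T : (Fin d → ℝ) → X →L[ℂ] X} (hT : IsIsometricRep T) (a g : Fin d → ℝ)
    (x : X) : T (-g) (cell hT a x) = ∫ t, phi a (t - g) • T (-t) x := by
  rw [cell_apply, act, ← ContinuousLinearMap.integral_comp_comm _
    (hT.integrable_smul (integrable_phi a) x),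
    ← integral_sub_right_eq_self (fun t => T (-g) (phi a t • T (-t) x)) g]
  refine integral_congr_ae (.of_forall fun t => ?_)
  beta_reduce
  rw [map_smul, ← ContinuousLinearMap.comp_apply, ← hT.map_add]
  congr 3
  abel

theorem exists_norm_phi_le (a : Fin d → ℝ) : ∃ C, ∀ s, ‖phi a s‖ ≤ C := by
  have h : ∃ D, ∀ x, fejer x ≤ D := by
    refine ⟨(2 * Real.pi)⁻¹ * ∫ l, triangle l, fun x => ?_⟩
    rw [fejer]
    gcongr ?_ * ?_
    refine (Real.le_norm_self _).trans (norm_integral_le_of_norm_le integrable_triangle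
      (.of_forall fun l => ?_))
    rw [norm_mul, Real.norm_of_nonneg (triangle_nonneg _)]
    exact mul_le_of_le_one_right (triangle_nonneg _) (Real.abs_cos_le_one _)
  obtain ⟨D, hD⟩ := h
  refine ⟨∏ _k : Fin d, D, fun s => ?_⟩
  rw [norm_phi]
  exact Finset.prod_le_prod (fun _ _ => fejer_nonneg _) fun _ _ => hD _

/-- The spectrum of a product is contained in the sum of the spectra, up to the width of the
cells. -/
theorem cell_mul_eq_zero [CompleteSpace B] (hT : IsIsometricAutRep T) {a b c : Fin d → ℝ}
    {k : Fin d} (h : 3 ≤ |c k - a k - b k|) (x y : B) :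
    cell hT.toIsIsometricRep c (cell hT.toIsIsometricRep a x * cell hT.toIsIsometricRep b y)
      = 0 := by
  have hR := hT.toIsIsometricRep
  have hX : ∀ x : B, Continuous fun t => T (-t) x := fun x => (hT.continuous x).comp continuous_neg
  have hk1 : Integrable fun g => phi c g • T (-g) (cell hR b y) :=
    hR.integrable_smul (integrable_phi c) _
  rw [cell_apply hR c, act]
  -- Multiplicativity of `T (-g)` lets two Fubini steps pull out `T (-s) x` and `T (-t) y`. What
  -- remains is the scalar integral of `phi c g * phi a (s - g) * phi b (t - g)`, which vanishes by
  -- the position of the supports.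
  have e1 : ∀ g, phi c g • T (-g) (cell hR a x * cell hR b y) =
      (∫ t, phi a (t - g) • T (-t) x) * (phi c g • T (-g) (cell hR b y)) := fun g => by
    rw [hT.map_mul, mul_smul_comm, hR.map_act_phi a]
  rw [integral_congr_ae (.of_forall e1), integral_integral_sub_smul_mul hk1 (integrable_phi a)
    (hX x) (C := ‖x‖) (fun t => (hR.norm_map _ _).le)]
  refine integral_eq_zero_of_ae (.of_forall fun s => ?_)
  obtain ⟨C, hC⟩ := exists_norm_phi_le a
  have hk2 : Integrable fun g => phi c g * phi a (s - g) :=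
    (integrable_phi c).mul_bdd (c := C)
      ((continuous_phi a).comp (by fun_prop)).aestronglyMeasurable (.of_forall fun g => hC _)
  have e2 : ∀ g, phi a (s - g) • phi c g • T (-g) (cell hR b y) =
      (∫ t, phi b (t - g) • T (-t) y) * ((phi c g * phi a (s - g)) • (1 : B)) := fun g => by
    rw [hR.map_act_phi b, smul_smul, mul_smul_comm, mul_one, mul_comm]
  beta_reduce
  rw [integral_congr_ae (.of_forall e2), integral_integral_sub_smul_mul (hk2.smul_const (1 : B))
    (integrable_phi b) (hX y) (C := ‖y‖) (fun t => (hR.norm_map _ _).le)]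
  have e3 : ∀ t, T (-t) y * ∫ g, phi b (t - g) • (phi c g * phi a (s - g)) • (1 : B) = 0 := by
    intro t
    simp_rw [smul_smul]
    rw [integral_smul_const, integral_congr_ae (.of_forall fun g => mul_comm (phi b (t - g)) _),
      integral_phi_mul_phi_mul_phi_eq_zero h, zero_smul, mul_zero]
  simp [e3]

/-- The product statement with `b = 0` and `y = 1`, since the cell at 0 fixes the unit. -/
theorem cell_cell_eq_zero [CompleteSpace B] (hT : IsIsometricAutRep T) {a c : Fin d → ℝ}
    {k : Fin d} (h : 3 ≤ |c k - a k|) (x : B) :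
    cell hT.toIsIsometricRep c (cell hT.toIsIsometricRep a x) = 0 := by
  have h1 := cell_mul_eq_zero hT (a := a) (b := 0) (c := c) (k := k) (by simpa using h) x 1
  rw [cell_one hT] at h1
  simpa [triangle] using h1

end Alg

end Cells

/-! ### Discrete Wiener and Beurling norms and their product estimates. -/

section Norms

open Filter Topology

variable {d : ℕ}

/-- The radially decreasing majorant of a family indexed by the integer lattice. -/
def majorant (h : (Fin d → ℤ) → ℝ≥0∞) (k : Fin d → ℤ) : ℝ≥0∞ :=
  ⨆ n : {n : Fin d → ℤ // ‖k‖ ≤ ‖n‖}, h n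

theorem le_majorant (h : (Fin d → ℤ) → ℝ≥0∞) {k n : Fin d → ℤ} (hn : ‖k‖ ≤ ‖n‖) :
    h n ≤ majorant h k :=
  le_iSup (fun n : {n : Fin d → ℤ // ‖k‖ ≤ ‖n‖} => h n) ⟨n, hn⟩

theorem majorant_le {h : (Fin d → ℤ) → ℝ≥0∞} {k : Fin d → ℤ} {C : ℝ≥0∞}
    (hC : ∀ n, ‖k‖ ≤ ‖n‖ → h n ≤ C) : majorant h k ≤ C :=
  iSup_le fun n => hC n n.2

/-- The integer lattice points of the box `[-r, r]^d`. -/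
def box (d r : ℕ) : Finset (Fin d → ℤ) := Fintype.piFinset fun _ => Finset.Icc (-r : ℤ) r

theorem mem_box {r : ℕ} {n : Fin d → ℤ} : n ∈ box d r ↔ ∀ k, |n k| ≤ r := by
  simp [box, Fintype.mem_piFinset, abs_le]

theorem card_box (d r : ℕ) : (box d r).card = (2 * r + 1) ^ d := by
  simp only [box, Fintype.card_piFinset_const, Int.card_Icc]
  congr 1
  omega

/-- Rounding to the nearest multiple of five, divided by five. -/
def round5 (k : Fin d → ℤ) : Fin d → ℤ := fun i => (k i + 2) / 5

theorem norm_le_of_abs_le {n : Fin d → ℤ} {r : ℤ} (hr : 0 ≤ r) (h : ∀ i, |n i| ≤ r) :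
    ‖n‖ ≤ r := by
  rw [pi_norm_le_iff_of_nonneg (by exact_mod_cast hr)]
  intro i
  rw [Int.norm_eq_abs]
  exact_mod_cast h i

theorem abs_le_of_norm_le {n : Fin d → ℤ} {r : ℤ} (h : ‖n‖ ≤ r) (i : Fin d) : |n i| ≤ r := by
  have := (norm_le_pi_norm n i).trans h
  rw [Int.norm_eq_abs] at this
  exact_mod_cast this

theorem exists_norm_eq (n : Fin d → ℤ) : ∃ r : ℤ, 0 ≤ r ∧ ‖n‖ = r := by
  rcases isEmpty_or_nonempty (Fin d) with h | h
  · exact ⟨0, le_rfl, by simp [Subsingleton.elim n 0]⟩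
  · obtain ⟨i, hi⟩ := Finite.exists_max fun i => |n i|
    refine ⟨|n i|, abs_nonneg _, le_antisymm (norm_le_of_abs_le (abs_nonneg _) hi) ?_⟩
    have := norm_le_pi_norm n i
    rw [Int.norm_eq_abs] at this
    exact_mod_cast this

/-- If `m` and `n` both had norm below `Q = ‖round5 k‖`, then `‖k‖ ≤ 2(Q-1) + 2 = 2Q`, and rounding
would give at most `Q - 1`. The factor five is already needed for `m = n = 0`, where every `k` of
norm 2 must round to 0. -/
theorem norm_round5_le {k c m n : Fin d → ℤ} (hkc : ‖k‖ ≤ ‖c‖) (h : c - m - n ∈ box d 2) :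
    ‖round5 k‖ ≤ ‖m‖ ∨ ‖round5 k‖ ≤ ‖n‖ := by
  by_contra! hcon
  obtain ⟨hm, hn⟩ := hcon
  obtain ⟨Q, hQ0, hQ⟩ := exists_norm_eq (round5 k)
  obtain ⟨M, hM0, hM⟩ := exists_norm_eq m
  obtain ⟨N, hN0, hN⟩ := exists_norm_eq n
  obtain ⟨R, hR0, hR⟩ := exists_norm_eq k
  rw [hQ, hM] at hm
  rw [hQ, hN] at hn
  have hm : M < Q := by exact_mod_cast hm
  have hn : N < Q := by exact_mod_cast hn
  have hc : ‖c‖ ≤ (M + N + 2 : ℤ) := by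
    refine norm_le_of_abs_le (by omega) fun i => ?_
    have h1 := abs_le_of_norm_le hM.le i
    have h2 := abs_le_of_norm_le hN.le i
    have h3 := mem_box.1 h i
    simp only [Pi.sub_apply] at h3
    rw [abs_le] at *
    push_cast at h3
    omega
  rw [hR] at hkc
  have hRc : R ≤ M + N + 2 := by exact_mod_cast hkc.trans hc
  have hQR : ‖round5 k‖ ≤ ((Q - 1 : ℤ) : ℝ) := by
    refine norm_le_of_abs_le (by omega) fun i => ?_
    have h1 := abs_le_of_norm_le hR.le i
    rw [abs_le] at *
    simp only [round5]
    omega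
  rw [hQ] at hQR
  have : Q ≤ Q - 1 := by exact_mod_cast hQR
  omega

/-- A residue mod 5 in each coordinate recovers `k` from `round5 k`, so the fibres have at most `5 ^
d` points. -/
theorem tsum_comp_round5_le (f : (Fin d → ℤ) → ℝ≥0∞) :
    ∑' k, f (round5 k) ≤ 5 ^ d * ∑' k, f k := by
  have hmod : ∀ a : ℤ, ((a + 2) % 5).toNat < 5 := fun a => by omega
  let e : (Fin d → ℤ) → (Fin d → ℤ) × (Fin d → Fin 5) :=
    fun k => (round5 k, fun i => ⟨((k i + 2) % 5).toNat, hmod (k i)⟩)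
  have he : Function.Injective e := by
    intro k l hkl
    ext i
    have h1 := congrFun (congrArg Prod.fst hkl) i
    have h2 := congrArg Fin.val (congrFun (congrArg Prod.snd hkl) i)
    simp only [e, round5] at h1 h2
    omega
  calc ∑' k, f (round5 k) = ∑' k, (fun p : (Fin d → ℤ) × (Fin d → Fin 5) => f p.1) (e k) := rfl
    _ ≤ ∑' p : (Fin d → ℤ) × (Fin d → Fin 5), f p.1 := ENNReal.tsum_comp_le_tsum_of_injective he _
    _ = ∑' k, ∑' _ : Fin d → Fin 5, f k := ENNReal.tsum_prod'
    _ = 5 ^ d * ∑' k, f k := by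
      simp [tsum_fintype, ENNReal.tsum_mul_left]

section Rep

variable {X : Type*} [NormedAddCommGroup X] [NormedSpace ℂ X] {T : (Fin d → ℝ) → X →L[ℂ] X}

/-- The family of the norms of the components of `x`. -/
def coeff (hT : IsIsometricRep T) (x : X) (n : Fin d → ℤ) : ℝ≥0∞ := ‖cell hT (toReal n) x‖ₑ

/-- The discrete version of the norm of the Wiener class. -/
def wnorm (hT : IsIsometricRep T) (x : X) : ℝ≥0∞ := ∑' n, coeff hT x n

/-- The norm of the Beurling class. -/
def bnorm (hT : IsIsometricRep T) (x : X) : ℝ≥0∞ := ∑' k, majorant (coeff hT x) k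

theorem wnorm_le_bnorm (hT : IsIsometricRep T) (x : X) : wnorm hT x ≤ bnorm hT x :=
  ENNReal.tsum_le_tsum fun _ => le_majorant _ le_rfl

theorem coeff_le (hT : IsIsometricRep T) (x : X) (n : Fin d → ℤ) : coeff hT x n ≤ ‖x‖ₑ :=
  enorm_cell_le hT _ x

theorem coeff_add_le (hT : IsIsometricRep T) (x y : X) (n : Fin d → ℤ) :
    coeff hT (x + y) n ≤ coeff hT x n + coeff hT y n := by
  rw [coeff, map_add]
  exact enorm_add_le _ _

theorem coeff_smul (hT : IsIsometricRep T) (c : ℂ) (x : X) (n : Fin d → ℤ) :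
    coeff hT (c • x) n = ‖c‖ₑ * coeff hT x n := by
  rw [coeff, map_smul, enorm_smul, coeff]

theorem wnorm_add_le (hT : IsIsometricRep T) (x y : X) :
    wnorm hT (x + y) ≤ wnorm hT x + wnorm hT y := by
  rw [wnorm, wnorm, wnorm, ← ENNReal.tsum_add]
  exact ENNReal.tsum_le_tsum (coeff_add_le hT x y)

theorem wnorm_smul (hT : IsIsometricRep T) (c : ℂ) (x : X) :
    wnorm hT (c • x) = ‖c‖ₑ * wnorm hT x := by
  simp only [wnorm, coeff_smul, ENNReal.tsum_mul_left]

theorem bnorm_add_le (hT : IsIsometricRep T) (x y : X) :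
    bnorm hT (x + y) ≤ bnorm hT x + bnorm hT y := by
  rw [bnorm, bnorm, bnorm, ← ENNReal.tsum_add]
  exact ENNReal.tsum_le_tsum fun k => majorant_le fun n hn =>
    (coeff_add_le hT x y n).trans (add_le_add (le_majorant _ hn) (le_majorant _ hn))

theorem bnorm_smul_le (hT : IsIsometricRep T) (c : ℂ) (x : X) :
    bnorm hT (c • x) ≤ ‖c‖ₑ * bnorm hT x := by
  rw [bnorm, bnorm, ← ENNReal.tsum_mul_left]
  exact ENNReal.tsum_le_tsum fun k => majorant_le fun n hn => by
    rw [coeff_smul]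
    gcongr
    exact le_majorant _ hn

theorem enorm_mul_le_mul_enorm {R : Type*} [NormedRing R] (x y : R) :
    ‖x * y‖ₑ ≤ ‖x‖ₑ * ‖y‖ₑ := by
  simp only [enorm]
  exact_mod_cast nnnorm_mul_le x y

theorem enorm_le_tsum_enorm {E ι : Type*} [NormedAddCommGroup E] {f : ι → E} {x : E}
    (h : HasSum f x) : ‖x‖ₑ ≤ ∑' i, ‖f i‖ₑ := by
  refine le_of_tendsto ((continuous_enorm.tendsto x).comp h) (.of_forall fun s => ?_)
  exact (enorm_sum_le _ _).trans (ENNReal.sum_le_tsum s)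

theorem coeff_le_tsum (hT : IsIsometricRep T) {ι : Type*} {f : ι → X} {x : X} (h : HasSum f x)
    (n : Fin d → ℤ) : coeff hT x n ≤ ∑' i, coeff hT (f i) n :=
  enorm_le_tsum_enorm (h.mapL (cell hT (toReal n)))

theorem wnorm_le_tsum (hT : IsIsometricRep T) {ι : Type*} {f : ι → X} {x : X} (h : HasSum f x) :
    wnorm hT x ≤ ∑' i, wnorm hT (f i) := by
  simp only [wnorm]
  rw [ENNReal.tsum_comm]
  exact ENNReal.tsum_le_tsum (coeff_le_tsum hT h)

theorem bnorm_le_tsum (hT : IsIsometricRep T) {ι : Type*} {f : ι → X} {x : X} (h : HasSum f x) :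
    bnorm hT x ≤ ∑' i, bnorm hT (f i) := by
  simp only [bnorm]
  rw [ENNReal.tsum_comm]
  exact ENNReal.tsum_le_tsum fun k => majorant_le fun n hn =>
    (coeff_le_tsum hT h n).trans (ENNReal.tsum_le_tsum fun i => le_majorant _ hn)

theorem wnorm_le_card (hT : IsIsometricRep T) {x : X} {s : Finset (Fin d → ℤ)}
    (h : ∀ n ∉ s, cell hT (toReal n) x = 0) : wnorm hT x ≤ s.card * ‖x‖ₑ := by
  rw [wnorm, tsum_eq_sum (s := s) fun n hn => by rw [coeff, h n hn, enorm_zero], ← nsmul_eq_mul]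
  exact Finset.sum_le_card_nsmul _ _ _ fun n _ => coeff_le hT x n

theorem bnorm_lt_top_of_box (hT : IsIsometricRep T) {x : X} {r : ℕ}
    (h : ∀ n ∉ box d r, cell hT (toReal n) x = 0) : bnorm hT x < ∞ := by
  rw [bnorm, tsum_eq_sum (s := box d r)]
  · exact ENNReal.sum_lt_top.2 fun k _ =>
      (majorant_le fun n _ => coeff_le hT x n).trans_lt enorm_lt_top
  · intro k hk
    refine le_antisymm (majorant_le fun n hn => ?_) bot_le
    rw [coeff, h n, enorm_zero]
    intro hn'
    apply hk
    rw [mem_box] at hn' ⊢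
    have : ‖n‖ ≤ ((r : ℤ) : ℝ) := norm_le_of_abs_le (by positivity) hn'
    exact abs_le_of_norm_le (hn.trans this)

/-- The components of `x` outside the box `[-r, r]^d` vanish. -/
def SpectrumIn (hT : IsIsometricRep T) (r : ℕ) (x : X) : Prop :=
  ∀ n ∉ box d r, cell hT (toReal n) x = 0

theorem SpectrumIn.wnorm_le {hT : IsIsometricRep T} {r : ℕ} {x : X} (h : SpectrumIn hT r x) :
    wnorm hT x ≤ (2 * r + 1) ^ d * ‖x‖ₑ := by
  refine (wnorm_le_card hT h).trans_eq ?_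
  rw [card_box]; simp

theorem SpectrumIn.wnorm_lt_top {hT : IsIsometricRep T} {r : ℕ} {x : X} (h : SpectrumIn hT r x) :
    wnorm hT x < ∞ :=
  h.wnorm_le.trans_lt (ENNReal.mul_lt_top (by exact_mod_cast ENNReal.natCast_lt_top _) enorm_lt_top)

theorem hasSum_cell_of_wnorm [CompleteSpace X] (hT : IsIsometricRep T) {x : X}
    (h : wnorm hT x < ∞) : HasSum (fun m : Fin d → ℤ => cell hT (toReal m) x) x := by
  apply hasSum_cell hT
  have := ENNReal.tsum_coe_ne_top_iff_summable.1
    (h.ne : ∑' n, (‖cell hT (toReal n) x‖₊ : ℝ≥0∞) ≠ ∞)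
  exact NNReal.summable_coe.2 this

end Rep

section Alg

variable {B : Type*} [NormedRing B] [NormedAlgebra ℂ B] [CompleteSpace B]
  {T : (Fin d → ℝ) → B →L[ℂ] B}

theorem cell_cell_eq_zero_of_not_mem (hT : IsIsometricAutRep T) {m n : Fin d → ℤ}
    (h : m - n ∉ box d 2) (x : B) :
    cell hT.toIsIsometricRep (toReal m) (cell hT.toIsIsometricRep (toReal n) x) = 0 := by
  rw [mem_box, not_forall] at h
  obtain ⟨k, hk⟩ := h
  refine cell_cell_eq_zero hT (k := k) ?_ x
  simp only [Pi.sub_apply, not_le, Nat.cast_ofNat] at hk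
  have : 3 ≤ |m k - n k| := by omega
  simp only [toReal]
  exact_mod_cast this

theorem cell_mul_eq_zero_of_not_mem (hT : IsIsometricAutRep T) {c m n : Fin d → ℤ}
    (h : c - m - n ∉ box d 2) (x y : B) :
    cell hT.toIsIsometricRep (toReal c) (cell hT.toIsIsometricRep (toReal m) x *
      cell hT.toIsIsometricRep (toReal n) y) = 0 := by
  rw [mem_box, not_forall] at h
  obtain ⟨k, hk⟩ := h
  refine cell_mul_eq_zero hT (k := k) ?_ x y
  simp only [Pi.sub_apply, not_le, Nat.cast_ofNat] at hk
  have : 3 ≤ |c k - m k - n k| := by omega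
  simp only [toReal]
  exact_mod_cast this

/-- Both factors are expanded into cells; only the pairs `(m, n)` with `c - m - n` in `box d 2`
contribute, and cells are contractions. The result is a convolution blurred by the shifts `j`. -/
theorem coeff_mul_le (hT : IsIsometricAutRep T) {x y : B} (hx : wnorm hT.toIsIsometricRep x < ∞)
    (hy : wnorm hT.toIsIsometricRep y < ∞) (c : Fin d → ℤ) :
    coeff hT.toIsIsometricRep (x * y) c ≤
      ∑ j ∈ box d 2, ∑' m, coeff hT.toIsIsometricRep x m *
        coeff hT.toIsIsometricRep y (c - m - j) := by
  classical
  have hR := hT.toIsIsometricRep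
  have h1 : coeff hR (x * y) c ≤ ∑' m, ∑' n, coeff hR (cell hR (toReal m) x *
      cell hR (toReal n) y) c := by
    refine (coeff_le_tsum hR ((hasSum_cell_of_wnorm hR hx).mul_right y) c).trans
      (ENNReal.tsum_le_tsum fun m => ?_)
    exact coeff_le_tsum hR ((hasSum_cell_of_wnorm hR hy).mul_left _) c
  have h2 : ∀ m n, coeff hR (cell hR (toReal m) x * cell hR (toReal n) y) c ≤
      ∑ j ∈ box d 2, if n = c - m - j then coeff hR x m * coeff hR y n else 0 := by
    intro m n
    by_cases h : c - m - n ∈ box d 2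
    · refine le_trans ?_ (Finset.single_le_sum (fun _ _ => zero_le) h)
      rw [if_pos (by abel)]
      refine (coeff_le hR _ c).trans ?_
      exact enorm_mul_le_mul_enorm _ _
    · rw [coeff, cell_mul_eq_zero_of_not_mem hT h, enorm_zero]
      exact zero_le
  refine h1.trans ((ENNReal.tsum_le_tsum fun m => ENNReal.tsum_le_tsum fun n => h2 m n).trans ?_)
  simp_rw [Summable.tsum_finsetSum fun _ _ => ENNReal.summable]
  refine Finset.sum_le_sum fun j _ => ENNReal.tsum_le_tsum fun m => ?_
  rw [tsum_ite_eq]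

theorem tsum_sub_sub {f : (Fin d → ℤ) → ℝ≥0∞} (c j : Fin d → ℤ) :
    ∑' m, f (c - m - j) = ∑' m, f m := by
  rw [← (Equiv.subLeft (c - j)).tsum_eq f]
  congr 1
  ext m
  simp only [Equiv.subLeft_apply]
  congr 1
  abel

theorem wnorm_mul_le (hT : IsIsometricAutRep T) {x y : B} (hx : wnorm hT.toIsIsometricRep x < ∞)
    (hy : wnorm hT.toIsIsometricRep y < ∞) :
    wnorm hT.toIsIsometricRep (x * y) ≤
      5 ^ d * (wnorm hT.toIsIsometricRep x * wnorm hT.toIsIsometricRep y) := by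
  refine (ENNReal.tsum_le_tsum (coeff_mul_le hT hx hy)).trans ?_
  rw [Summable.tsum_finsetSum fun _ _ => ENNReal.summable]
  have h : ∀ j : Fin d → ℤ, ∑' c : Fin d → ℤ, ∑' m, coeff hT.toIsIsometricRep x m *
      coeff hT.toIsIsometricRep y (c - m - j) =
      wnorm hT.toIsIsometricRep x * wnorm hT.toIsIsometricRep y := by
    intro j
    rw [ENNReal.tsum_comm]
    simp_rw [ENNReal.tsum_mul_left, sub_sub]
    rw [wnorm, ← ENNReal.tsum_mul_right]
    congr 1
    ext m
    congr 1
    exact (Equiv.subRight (m + j)).tsum_eq (coeff hT.toIsIsometricRep y)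
  simp_rw [h]
  rw [Finset.sum_const, card_box, nsmul_eq_mul]
  simp

/-- An index far from 0 in the product forces a far index in one factor. That factor is bounded by
its majorant and the other is summed. One factor `5 ^ d` counts the shifts `j`, the other the fibres
of `round5`. -/
theorem bnorm_mul_le (hT : IsIsometricAutRep T) {x y : B} (hx : wnorm hT.toIsIsometricRep x < ∞)
    (hy : wnorm hT.toIsIsometricRep y < ∞) :
    bnorm hT.toIsIsometricRep (x * y) ≤
      25 ^ d * (bnorm hT.toIsIsometricRep x * wnorm hT.toIsIsometricRep y +
        wnorm hT.toIsIsometricRep x * bnorm hT.toIsIsometricRep y) := by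
  have hR := hT.toIsIsometricRep
  have h1 : ∀ k, majorant (coeff hR (x * y)) k ≤ 5 ^ d *
      (majorant (coeff hR x) (round5 k) * wnorm hR y +
        wnorm hR x * majorant (coeff hR y) (round5 k)) := by
    intro k
    refine majorant_le fun c hc => (coeff_mul_le hT hx hy c).trans ?_
    have h2 : ∀ j ∈ box d 2, ∑' m, coeff hR x m * coeff hR y (c - m - j) ≤
        majorant (coeff hR x) (round5 k) * wnorm hR y +
        wnorm hR x * majorant (coeff hR y) (round5 k) := by
      intro j hj
      have h3 : ∀ m, coeff hR x m * coeff hR y (c - m - j) ≤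
          majorant (coeff hR x) (round5 k) * coeff hR y (c - m - j) +
          coeff hR x m * majorant (coeff hR y) (round5 k) := by
        intro m
        rcases norm_round5_le (m := m) (n := c - m - j) hc (by rwa [sub_sub_cancel]) with h | h
        · exact le_add_right (mul_le_mul_left (le_majorant _ h) _)
        · exact le_add_left (mul_le_mul_right (le_majorant _ h) _)
      refine (ENNReal.tsum_le_tsum h3).trans_eq ?_
      rw [ENNReal.tsum_add, ENNReal.tsum_mul_left, ENNReal.tsum_mul_right, tsum_sub_sub]
      rfl
    refine (Finset.sum_le_card_nsmul _ _ _ h2).trans_eq ?_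
    rw [card_box, nsmul_eq_mul]
    simp
  refine (ENNReal.tsum_le_tsum h1).trans ?_
  rw [ENNReal.tsum_mul_left, ENNReal.tsum_add, ENNReal.tsum_mul_left, ENNReal.tsum_mul_right,
    show (25 : ℝ≥0∞) = 5 * 5 by norm_num, mul_pow, mul_assoc]
  gcongr
  calc _ ≤ 5 ^ d * bnorm hR x * wnorm hR y + wnorm hR x * (5 ^ d * bnorm hR y) := by
        gcongr <;> exact tsum_comp_round5_le _
    _ = _ := by ring

theorem SpectrumIn.mul (hT : IsIsometricAutRep T) {r s : ℕ} {x y : B}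
    (hx : SpectrumIn hT.toIsIsometricRep r x) (hy : SpectrumIn hT.toIsIsometricRep s y) :
    SpectrumIn hT.toIsIsometricRep (r + s + 2) (x * y) := by
  intro c hc
  have h := coeff_mul_le hT hx.wnorm_lt_top hy.wnorm_lt_top c
  rw [← enorm_eq_zero]
  refine le_antisymm (h.trans_eq ?_) zero_le
  refine Finset.sum_eq_zero fun j hj => ENNReal.tsum_eq_zero.2 fun m => ?_
  by_cases hm : m ∈ box d r
  · rw [coeff, coeff, hy _ fun hn => hc ?_, enorm_zero, mul_zero]
    rw [mem_box] at *
    intro k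
    have h1 := hm k
    have h2 := hj k
    have h3 := hn k
    simp only [Pi.sub_apply] at h3
    rw [abs_le] at *
    push_cast at *
    omega
  · rw [coeff, hx m hm, enorm_zero, zero_mul]

theorem spectrumIn_one (hT : IsIsometricAutRep T) : SpectrumIn hT.toIsIsometricRep 0 (1 : B) := by
  intro n hn
  rw [mem_box, not_forall] at hn
  obtain ⟨k, hk⟩ := hn
  rw [cell_one hT, Finset.prod_eq_zero (Finset.mem_univ k), zero_smul]
  rw [Complex.ofReal_eq_zero, toReal]
  apply triangle_eq_zero
  have : 1 ≤ |n k| := by simp only [Nat.cast_zero, not_le] at hk; omega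
  exact_mod_cast this

theorem spectrumIn_cell (hT : IsIsometricAutRep T) (n : Fin d → ℤ) (x : B) :
    ∃ r, SpectrumIn hT.toIsIsometricRep r (cell hT.toIsIsometricRep (toReal n) x) := by
  obtain ⟨R, hR0, hR⟩ := exists_norm_eq n
  refine ⟨R.toNat + 2, fun m hm => cell_cell_eq_zero_of_not_mem hT (fun h => hm ?_) x⟩
  rw [mem_box] at *
  intro k
  have h1 := abs_le_of_norm_le hR.le k
  have h2 := h k
  simp only [Pi.sub_apply] at h2
  rw [abs_le] at *
  push_cast at *
  omega

theorem spectrumIn_cell_zero (hT : IsIsometricAutRep T) (x : B) :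
    SpectrumIn hT.toIsIsometricRep 2 (cell hT.toIsIsometricRep 0 x) := by
  intro m hm
  have := cell_cell_eq_zero_of_not_mem hT (m := m) (n := 0) (by rwa [sub_zero]) x
  rwa [show toReal (0 : Fin d → ℤ) = 0 by ext; simp [toReal]] at this

/-- Each new factor adds its radius 2 and a blur of 2. Linear growth of the radius keeps the Wiener
norm of `x ^ k` within a polynomial factor of its norm. -/
theorem SpectrumIn.pow (hT : IsIsometricAutRep T) {x : B}
    (hx : SpectrumIn hT.toIsIsometricRep 2 x) (k : ℕ) :
    SpectrumIn hT.toIsIsometricRep (4 * k) (x ^ k) := by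
  induction k with
  | zero => simpa using spectrumIn_one hT
  | succ k ih => rw [pow_succ]; exact ih.mul hT hx

end Alg

end Norms

/-! ### Inverting `1 - z` for `‖z‖ < 1` inside the two algebras. -/

section Resolvents

open Filter Topology

variable {d : ℕ}

theorem pow_eq_add_sum {R : Type*} [Ring R] (y z : R) (n : ℕ) :
    z ^ n = y ^ n + ∑ k ∈ Finset.range n, y ^ k * ((z - y) * z ^ (n - 1 - k)) := by
  induction n with
  | zero => simp
  | succ n ih =>
    rw [Finset.sum_range_succ']
    simp only [pow_zero, one_mul, add_tsub_cancel_right, tsub_zero]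
    have : ∀ k ∈ Finset.range n, y ^ (k + 1) * ((z - y) * z ^ (n - (k + 1))) =
        y * (y ^ k * ((z - y) * z ^ (n - 1 - k))) := by
      intro k _
      rw [pow_succ', mul_assoc, Nat.sub_sub, add_comm 1 k]
    rw [Finset.sum_congr rfl this, ← Finset.mul_sum, pow_succ' y, ← add_assoc, ← mul_add, ← ih,
      ← add_mul, add_sub_cancel, ← pow_succ']

/-- The norm of the unit is not assumed to be 1; the constant covers `n = 0`. -/
theorem enorm_pow_le_mul {R : Type*} [NormedRing R] (x : R) (n : ℕ) :
    ‖x ^ n‖ₑ ≤ (‖(1 : R)‖ₑ + 1) * ‖x‖ₑ ^ n := by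
  rcases n with _ | n
  · simp
  · refine le_trans ?_ (mul_le_mul_left (le_add_self) _)
    rw [one_mul]
    simp only [enorm]
    exact_mod_cast nnnorm_pow_le' x n.succ_pos

/-- If `y ∈ S` is close to `u⁻¹`, then `u y = 1 - z` with `‖z‖ < 1`; a right inverse `v ∈ S` of it
makes `y v` the inverse of `u`. -/
theorem inv_mem_of_dense {B : Type*} [NormedRing B] [Algebra ℂ B] (S : Subalgebra ℂ B)
    (hd : ∀ x : B, ∀ ε : ℝ, 0 < ε → ∃ y ∈ S, ‖x - y‖ < ε)
    (hS : ∀ z ∈ S, ‖z‖ < 1 → ∃ v ∈ S, (1 - z) * v = 1) (u : Bˣ) (hu : (u : B) ∈ S) :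
    ((u⁻¹ : Bˣ) : B) ∈ S := by
  obtain ⟨y, hy, hyu⟩ := hd ((u⁻¹ : Bˣ) : B) (‖(u : B)‖ + 1)⁻¹ (by positivity)
  have h1 : ‖1 - u * y‖ < 1 := by
    have : 1 - u * y = u * (((u⁻¹ : Bˣ) : B) - y) := by rw [mul_sub, Units.mul_inv]
    rw [this]
    calc _ ≤ ‖(u : B)‖ * ‖((u⁻¹ : Bˣ) : B) - y‖ := norm_mul_le _ _
      _ ≤ (‖(u : B)‖ + 1) * ‖((u⁻¹ : Bˣ) : B) - y‖ := by gcongr; linarith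
      _ < (‖(u : B)‖ + 1) * (‖(u : B)‖ + 1)⁻¹ := by gcongr
      _ = 1 := mul_inv_cancel₀ (by positivity)
  obtain ⟨v, hv, hv1⟩ := hS _ (S.sub_mem S.one_mem (S.mul_mem hu hy)) h1
  rw [sub_sub_cancel, mul_assoc] at hv1
  rw [Units.inv_eq_of_mul_eq_one_right hv1]
  exact S.mul_mem hy hv

section Dilation

variable {X : Type*} [NormedAddCommGroup X] [NormedSpace ℂ X] {T : (Fin d → ℝ) → X →L[ℂ] X}

/-- The weight is nonzero only if each `n k` is within distance 1 of `m k / N`, which leaves the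
floor and its successor. -/
theorem enorm_prod_triangle_le (N : ℕ) (m n : Fin d → ℤ) :
    ‖((∏ k, triangle (m k / N - n k) : ℝ) : ℂ)‖ₑ ≤
      ∑ j ∈ Fintype.piFinset fun _ : Fin d => Finset.Icc (0 : ℤ) 1,
        if n = (fun k => ⌊(m k / N : ℝ)⌋) + j then 1 else 0 := by
  by_cases h : ∃ k, triangle (m k / N - n k) = 0
  · obtain ⟨k, hk⟩ := h
    rw [Finset.prod_eq_zero (Finset.mem_univ k) hk, Complex.ofReal_zero, enorm_zero]
    exact zero_le
  · push Not at h
    have hj : n - (fun k => ⌊(m k / N : ℝ)⌋) ∈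
        Fintype.piFinset fun _ : Fin d => Finset.Icc (0 : ℤ) 1 := by
      rw [Fintype.mem_piFinset]
      intro k
      have h1 : |(m k / N - n k : ℝ)| < 1 := by
        by_contra! h'
        exact h k (triangle_eq_zero h')
      rw [abs_lt] at h1
      have h2 := Int.floor_le (m k / N : ℝ)
      have h3 := Int.lt_floor_add_one (m k / N : ℝ)
      simp only [Pi.sub_apply, Finset.mem_Icc]
      have h4 : (⌊(m k / N : ℝ)⌋ : ℝ) < n k + 1 := by linarith
      have h5 : (n k : ℝ) < ⌊(m k / N : ℝ)⌋ + 1 + 1 := by linarith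
      have h4' : ⌊(m k / N : ℝ)⌋ < n k + 1 := by exact_mod_cast h4
      have h5' : n k < ⌊(m k / N : ℝ)⌋ + 1 + 1 := by exact_mod_cast h5
      omega
    refine le_trans ?_ (Finset.single_le_sum (fun _ _ => zero_le) hj)
    rw [if_pos (by abel), ← ofReal_norm, Complex.norm_real, Real.norm_of_nonneg
      (Finset.prod_nonneg fun _ _ => triangle_nonneg _), ← ENNReal.ofReal_one]
    exact ENNReal.ofReal_le_ofReal
      (Finset.prod_le_one (fun _ _ => triangle_nonneg _) fun _ _ => triangle_le_one _)

/-- A unit cell enters at most `2 ^ d` coarse cells. That the constant does not depend on `N` is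
essential when `N` is chosen later. -/
theorem wnorm_dilate_le (hT : IsIsometricRep T) {N : ℕ} (hN : 1 ≤ N) (x : X) :
    wnorm (hT.dilate N) x ≤ 2 ^ d * wnorm hT x := by
  have h1 : ∀ n, coeff (hT.dilate N) x n ≤
      ∑' m : Fin d → ℤ, ∑ j ∈ Fintype.piFinset fun _ : Fin d => Finset.Icc (0 : ℤ) 1,
        if n = (fun k => ⌊(m k / N : ℝ)⌋) + j then coeff hT x m else 0 := by
    intro n
    rw [coeff, cell_dilate hT N hN]
    refine (enorm_sum_le _ _).trans ((ENNReal.sum_le_tsum _).trans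
      (ENNReal.tsum_le_tsum fun m => ?_))
    rw [enorm_smul]
    refine (mul_le_mul_left (enorm_prod_triangle_le N m n) _).trans_eq ?_
    rw [Finset.sum_mul]
    simp only [ite_mul, one_mul, zero_mul]
    rfl
  refine (ENNReal.tsum_le_tsum h1).trans_eq ?_
  rw [ENNReal.tsum_comm]
  simp_rw [Summable.tsum_finsetSum fun _ _ => ENNReal.summable, tsum_ite_eq]
  simp only [Finset.sum_const, Fintype.card_piFinset_const, nsmul_eq_mul]
  simp [wnorm]

end Dilation

variable {B : Type*} [NormedRing B] [NormedAlgebra ℂ B] [CompleteSpace B]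
  {T : (Fin d → ℝ) → B →L[ℂ] B}

theorem wnorm_le_dilate (hT : IsIsometricAutRep T) {N : ℕ} (hN : 1 ≤ N) (x : B) :
    wnorm hT.toIsIsometricRep x ≤
      (2 * N + 5) ^ d * wnorm (hT.dilate N).toIsIsometricRep x := by
  have hR := hT.toIsIsometricRep
  rcases eq_or_ne (wnorm (hR.dilate N) x) ∞ with h | h
  · rw [show wnorm (hT.dilate N).toIsIsometricRep x = ∞ from h, ENNReal.mul_top]
    · exact le_top
    · simp
  refine (wnorm_le_tsum hR (hasSum_cell_of_wnorm (hR.dilate N) h.lt_top)).trans ?_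
  rw [wnorm, ← ENNReal.tsum_mul_left]
  refine ENNReal.tsum_le_tsum fun n => ?_
  -- A coarse cell combines unit cells with indices in `[N(n-1), N(n+1)]`, and each reaches 2
  -- further on both sides: `2N + 5` indices per coordinate. Dependence on `N` is harmless, as the
  -- estimate is used with `N` fixed.
  refine (wnorm_le_card hR (s := Fintype.piFinset fun k =>
    Finset.Icc (N * (n k - 1) - 2) (N * (n k + 1) + 2 : ℤ)) fun m hm => ?_).trans_eq ?_
  · rw [cell_dilate hR N hN, map_sum]
    refine Finset.sum_eq_zero fun j hj => ?_
    rw [map_smul, cell_cell_eq_zero_of_not_mem hT, smul_zero]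
    intro h'
    apply hm
    rw [Fintype.mem_piFinset] at *
    intro k
    have h1 := hj k
    have h2 := mem_box.1 h' k
    rw [Finset.mem_Icc] at *
    simp only [Pi.sub_apply] at h2
    rw [abs_le] at h2
    push_cast at h2
    constructor <;> linarith [h1.1, h1.2, h2.1, h2.2]
  · congr 1
    rw [Fintype.card_piFinset]
    have : ∀ k, (Finset.Icc (N * (n k - 1) - 2) (N * (n k + 1) + 2 : ℤ)).card = 2 * N + 5 := by
      intro k
      rw [Int.card_Icc]
      have : (N * (n k + 1) + 2 + 1 - (N * (n k - 1) - 2) : ℤ) = 2 * N + 5 := by ring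
      omega
    simp [this]

/-- The error is the sum of the cells with coefficients `1 - weight N m`, which tend to 0; dominated
convergence applies, as a single cell has Wiener norm at most `5 ^ d` times its norm. -/
theorem tendsto_wnorm_sub_cell_dilate (hT : IsIsometricAutRep T) {x : B}
    (hx : wnorm hT.toIsIsometricRep x < ∞) :
    Tendsto (fun N : ℕ => wnorm hT.toIsIsometricRep
      (x - cell (hT.dilate N).toIsIsometricRep 0 x)) atTop (𝓝 0) := by
  have hR := hT.toIsIsometricRep
  have hs : Summable fun m : Fin d → ℤ => ‖cell hR (toReal m) x‖ :=
    NNReal.summable_coe.2 (ENNReal.tsum_coe_ne_top_iff_summable.1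
      (hx.ne : ∑' n, (‖cell hR (toReal n) x‖₊ : ℝ≥0∞) ≠ ∞))
  have hw : ∀ N (m : Fin d → ℤ), 0 ≤ 1 - weight N m := fun N m => sub_nonneg.2 (weight_le_one N m)
  have hle : ∀ N (m : Fin d → ℤ), (1 - weight N m) * ‖cell hR (toReal m) x‖ ≤
      ‖cell hR (toReal m) x‖ := fun N m =>
    mul_le_of_le_one_left (norm_nonneg _) (by linarith [weight_nonneg N m])
  have h1 : Tendsto (fun N : ℕ => ∑' m : Fin d → ℤ,
      (1 - weight N m) * ‖cell hR (toReal m) x‖) atTop (𝓝 0) := by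
    have : (0 : ℝ) = ∑' _ : Fin d → ℤ, (0 : ℝ) := tsum_zero.symm
    rw [this]
    refine tendsto_tsum_of_dominated_convergence hs (fun m => ?_) (.of_forall fun N m => ?_)
    · simpa using ((tendsto_weight m).const_sub 1).mul_const ‖cell hR (toReal m) x‖
    · rw [Real.norm_of_nonneg (mul_nonneg (hw N m) (norm_nonneg _))]
      exact hle N m
  have h2 : Tendsto (fun N : ℕ => 5 ^ d * ENNReal.ofReal (∑' m : Fin d → ℤ,
      (1 - weight N m) * ‖cell hR (toReal m) x‖)) atTop (𝓝 0) := by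
    have := ENNReal.Tendsto.const_mul (a := 5 ^ d) (ENNReal.tendsto_ofReal h1)
      (Or.inr (by simp))
    simpa using this
  refine tendsto_of_tendsto_of_tendsto_of_le_of_le' tendsto_const_nhds h2
    (.of_forall fun _ => zero_le) ?_
  filter_upwards [eventually_ge_atTop 1] with N hN
  have h3 := (hasSum_cell_of_wnorm hR hx).sub (hasSum_weight_smul_cell hR N hN x)
  refine (wnorm_le_tsum hR h3).trans ?_
  rw [ENNReal.ofReal_tsum_of_nonneg (fun m => mul_nonneg (hw N m) (norm_nonneg _))
    (Summable.of_nonneg_of_le (fun m => mul_nonneg (hw N m) (norm_nonneg _)) (hle N) hs),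
    ← ENNReal.tsum_mul_left]
  refine ENNReal.tsum_le_tsum fun m => ?_
  have e1 : cell hR (toReal m) x - (weight N m : ℂ) • cell hR (toReal m) x =
      ((1 - weight N m : ℝ) : ℂ) • cell hR (toReal m) x := by
    push_cast; rw [sub_smul, one_smul]
  have e2 : wnorm hR (cell hR (toReal m) x) ≤ 5 ^ d * ‖cell hR (toReal m) x‖ₑ := by
    classical
    refine (wnorm_le_card hR (s := (box d 2).image (· + m)) fun n hn => ?_).trans ?_
    · refine cell_cell_eq_zero_of_not_mem hT (fun h => hn ?_) x
      exact Finset.mem_image.2 ⟨n - m, h, sub_add_cancel _ _⟩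
    · gcongr
      have : ((box d 2).image (· + m)).card ≤ 5 ^ d :=
        Finset.card_image_le.trans_eq (card_box d 2)
      exact_mod_cast this
  rw [e1, wnorm_smul, ENNReal.ofReal_mul (hw N m), ofReal_norm, mul_left_comm,
    ← ofReal_norm (_ : ℂ), Complex.norm_real, Real.norm_of_nonneg (hw N m)]
  gcongr

theorem wnorm_pow_lt_top (hT : IsIsometricAutRep T) {x : B}
    (hx : wnorm hT.toIsIsometricRep x < ∞) (n : ℕ) : wnorm hT.toIsIsometricRep (x ^ n) < ∞ := by
  induction n with
  | zero => rw [pow_zero]; exact (spectrumIn_one hT).wnorm_lt_top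
  | succ n ih =>
    rw [pow_succ]
    exact (wnorm_mul_le hT ih hx).trans_lt
      (ENNReal.mul_lt_top (by simp) (ENNReal.mul_lt_top ih hx))

/-- A partial sum `S` satisfies `S ≤ G + c G S ≤ G + S/2`, and `S` is finite, so half of it can be
absorbed. -/
theorem tsum_le_of_le_add_convolution {a g : ℕ → ℝ≥0∞} {c G : ℝ≥0∞} (ha : ∀ n, a n ≠ ∞)
    (hg : ∑' n, g n ≤ G) (hc : c * G ≤ 1 / 2)
    (h : ∀ n, a n ≤ g n + c * ∑ k ∈ Finset.range n, g k * a (n - 1 - k)) :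
    ∑' n, a n ≤ 2 * G := by
  refine ENNReal.tsum_le_of_sum_range_le fun M => ?_
  set S := ∑ n ∈ Finset.range M, a n with hS
  have hSt : S ≠ ∞ := ENNReal.sum_ne_top.2 fun n _ => ha n
  have hgM : ∀ M, ∑ n ∈ Finset.range M, g n ≤ G := fun M => (ENNReal.sum_le_tsum _).trans hg
  have hconv : ∑ n ∈ Finset.range M, ∑ k ∈ Finset.range n, g k * a (n - 1 - k) ≤ G * S := by
    rcases M with _ | M
    · simp
    rw [Finset.sum_range_succ']
    simp only [add_tsub_cancel_right, Finset.range_zero, Finset.sum_empty, add_zero]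
    rw [Finset.sum_range_diag_flip M fun k j => g k * a j]
    simp_rw [← Finset.mul_sum]
    calc _ ≤ ∑ m ∈ Finset.range M, g m * S := by
          gcongr with m hm
          exact Finset.sum_le_sum_of_subset
            (Finset.range_mono ((Nat.sub_le _ _).trans (Nat.le_succ _)))
      _ ≤ _ := by rw [← Finset.sum_mul]; gcongr; exact hgM M
  have h1 : S ≤ G + S / 2 := by
    calc S ≤ ∑ n ∈ Finset.range M, (g n + c * ∑ k ∈ Finset.range n, g k * a (n - 1 - k)) :=
          Finset.sum_le_sum fun n _ => h n
      _ ≤ G + c * (G * S) := by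
          rw [Finset.sum_add_distrib, ← Finset.mul_sum]
          gcongr
          exact hgM M
      _ ≤ G + 1 / 2 * S := by rw [← mul_assoc]; gcongr
      _ = G + S / 2 := by rw [one_div, ENNReal.div_eq_inv_mul]
  have h2 : S / 2 + S / 2 ≤ G + S / 2 := by rwa [ENNReal.add_halves]
  have h3 : S / 2 ≤ G := by
    refine (ENNReal.add_le_add_iff_right ?_).1 h2
    exact (ENNReal.div_lt_top hSt (by simp)).ne
  rw [← ENNReal.add_halves S, two_mul]
  exact add_le_add h3 h3

theorem tsum_pow_mul_geometric_ne_top {r : ℝ≥0∞} (hr : r < 1) {M : ℝ≥0∞} (hM : M ≠ ∞) (d : ℕ) :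
    ∑' k : ℕ, (2 * ((4 * k : ℕ) : ℝ≥0∞) + 1) ^ d * (M * r ^ k) ≠ ∞ := by
  lift M to NNReal using hM
  lift r to NNReal using (hr.trans ENNReal.one_lt_top).ne
  have hr1 : r < 1 := by exact_mod_cast hr
  have h0 : Summable fun k : ℕ => (k : NNReal) ^ d * r ^ k := by
    rw [← NNReal.summable_coe]
    push_cast
    exact summable_pow_mul_geometric_of_norm_lt_one d (by simpa using hr1)
  have h1 : Summable fun k : ℕ => r ^ k := NNReal.summable_geometric hr1
  have h2 : Summable fun k : ℕ => (2 * ((4 * k : ℕ) : NNReal) + 1) ^ d * (M * r ^ k) := by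
    -- `8k + 1 ≤ 9k` for `k ≥ 1`; the added geometric series covers `k = 0`.
    refine NNReal.summable_of_le (fun k => ?_) ((h0.add h1).mul_left (9 ^ d * M))
    rw [show (9 ^ d * M) * ((k : NNReal) ^ d * r ^ k + r ^ k) =
      (9 ^ d * ((k : NNReal) ^ d + 1)) * (M * r ^ k) by ring]
    gcongr
    rcases Nat.eq_zero_or_pos k with rfl | hk
    · simp only [mul_zero, Nat.cast_zero, zero_add, one_pow]
      exact one_le_mul (one_le_pow₀ (by norm_num)) le_add_self
    · calc _ ≤ (9 * (k : NNReal)) ^ d := by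
            gcongr
            have : 2 * (4 * k) + 1 ≤ 9 * k := by omega
            exact_mod_cast this
        _ ≤ _ := by rw [mul_pow]; gcongr; exact le_self_add
  have h3 := ENNReal.tsum_coe_ne_top_iff_summable.2 h2
  push_cast at h3 ⊢
  exact h3

/-- The core of the argument. Coarse cells make the powers of the truncation `y` cheap, and the
error `z - y` is small for large `N`. -/
theorem exists_tsum_wnorm_pow_lt_top (hT : IsIsometricAutRep T) {z : B}
    (hz : wnorm hT.toIsIsometricRep z < ∞) (hz1 : ‖z‖ < 1) :
    ∃ N : ℕ, 1 ≤ N ∧ ∑' n, wnorm (hT.dilate N).toIsIsometricRep (z ^ n) < ∞ := by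
  have hR := hT.toIsIsometricRep
  set M : ℝ≥0∞ := ‖(1 : B)‖ₑ + 1 with hM
  have hMt : M ≠ ∞ := by simp [hM]
  have hr : ‖z‖ₑ < 1 := by
    rw [← ofReal_norm, ← ENNReal.ofReal_one]
    exact (ENNReal.ofReal_lt_ofReal_iff one_pos).2 hz1
  -- Bounds the sum of the coarse Wiener norms of `y ^ k`, which has spectrum radius `4k` and norm
  -- at most `M ‖z‖^k`. It does not involve `N`, so `N` can be chosen after it.
  set G := ∑' k : ℕ, (2 * ((4 * k : ℕ) : ℝ≥0∞) + 1) ^ d * (M * ‖z‖ₑ ^ k) with hG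
  have hGt : G ≠ ∞ := tsum_pow_mul_geometric_ne_top hr hMt d
  -- `25 ^ d` pays for the two products in `y^k ((z - y) z^(n-1-k))`, and `2 ^ d` for measuring `z -
  -- y` in the coarse norm.
  have hlim : Tendsto (fun N : ℕ => (25 ^ d * (2 ^ d * wnorm hR
      (z - cell (hR.dilate N) 0 z))) * G) atTop (𝓝 0) := by
    have h1 := ENNReal.Tendsto.const_mul (a := 2 ^ d) (tendsto_wnorm_sub_cell_dilate hT hz)
      (Or.inr (by simp))
    have h2 := ENNReal.Tendsto.const_mul (a := 25 ^ d) h1 (Or.inr (by simp))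
    have h3 := ENNReal.Tendsto.mul_const (b := G) h2 (Or.inr hGt)
    simpa using h3
  obtain ⟨N, hN, hN1⟩ := ((hlim.eventually_le_const (u := 1 / 2) (by simp)).and
    (eventually_ge_atTop 1)).exists
  refine ⟨N, hN1, ?_⟩
  have hTN := hT.dilate N
  have hRN := hR.dilate N
  set y := cell hRN 0 z with hy
  have hyS : ∀ k, SpectrumIn hRN (4 * k) (y ^ k) := (spectrumIn_cell_zero hTN z).pow hTN
  have hzN : wnorm hRN z < ∞ :=
    (wnorm_dilate_le hR hN1 z).trans_lt (ENNReal.mul_lt_top (by simp) hz)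
  have heN : wnorm hRN (z - y) ≤ 2 ^ d * wnorm hR (z - y) := wnorm_dilate_le hR hN1 _
  have heN' : wnorm hRN (z - y) < ∞ := by
    have h1 : SpectrumIn hRN 2 y := spectrumIn_cell_zero hTN z
    have h2 := wnorm_add_le hRN z ((-1 : ℂ) • y)
    rw [wnorm_smul, neg_one_smul, ← sub_eq_add_neg] at h2
    exact h2.trans_lt (ENNReal.add_lt_top.2 ⟨hzN, ENNReal.mul_lt_top (by simp) h1.wnorm_lt_top⟩)
  refine (tsum_le_of_le_add_convolution (g := fun k => wnorm hRN (y ^ k)) (G := G)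
    (fun n => (wnorm_pow_lt_top hTN hzN n).ne) ?_ hN fun n => ?_).trans_lt
      (ENNReal.mul_lt_top (by simp) hGt.lt_top)
  · refine ENNReal.tsum_le_tsum fun k => (hyS k).wnorm_le.trans ?_
    gcongr
    refine (enorm_pow_le_mul y k).trans ?_
    gcongr
    exact enorm_cell_le hRN 0 z
  · have hsum : wnorm hRN (∑ k ∈ Finset.range n, y ^ k * ((z - y) * z ^ (n - 1 - k))) ≤
        ∑ k ∈ Finset.range n, wnorm hRN (y ^ k * ((z - y) * z ^ (n - 1 - k))) := by
      have := wnorm_le_tsum hRN (hasSum_fintype fun k : Finset.range n =>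
        y ^ (k : ℕ) * ((z - y) * z ^ (n - 1 - k)))
      rwa [Finset.univ_eq_attach, Finset.sum_attach (Finset.range n)
        fun k => y ^ (k : ℕ) * ((z - y) * z ^ (n - 1 - k)), Finset.tsum_subtype (Finset.range n)
        fun k => wnorm hRN (y ^ (k : ℕ) * ((z - y) * z ^ (n - 1 - k)))] at this
    rw [pow_eq_add_sum y z n]
    refine (wnorm_add_le hRN _ _).trans (add_le_add le_rfl (hsum.trans ?_))
    rw [Finset.mul_sum]
    refine Finset.sum_le_sum fun k _ => ?_
    have hzp := wnorm_pow_lt_top hTN hzN (n - 1 - k)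
    have h1 := wnorm_mul_le hTN heN' hzp
    refine (wnorm_mul_le hTN (hyS k).wnorm_lt_top (h1.trans_lt
      (ENNReal.mul_lt_top (by simp) (ENNReal.mul_lt_top heN' hzp)))).trans ?_
    calc _ ≤ 5 ^ d * (wnorm hRN (y ^ k) * (5 ^ d * ((2 ^ d * wnorm hR (z - y)) *
          wnorm hRN (z ^ (n - 1 - k))))) := by
          gcongr
          exact h1.trans (by gcongr)
      _ = _ := by
          rw [show (25 : ℝ≥0∞) = 5 * 5 by norm_num, mul_pow]
          ring

theorem exists_wnorm_mul_eq_one (hT : IsIsometricAutRep T) {z : B}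
    (hz : wnorm hT.toIsIsometricRep z < ∞) (hz1 : ‖z‖ < 1) :
    ∃ v, wnorm hT.toIsIsometricRep v < ∞ ∧ (1 - z) * v = 1 := by
  obtain ⟨N, hN, h⟩ := exists_tsum_wnorm_pow_lt_top hT hz hz1
  refine ⟨∑' n, z ^ n, ?_, mul_neg_geom_series z (by simpa using hz1)⟩
  refine (wnorm_le_dilate hT hN _).trans_lt (ENNReal.mul_lt_top ?_ ?_)
  · exact_mod_cast ENNReal.natCast_lt_top _
  · exact (wnorm_le_tsum _ (summable_geometric_of_norm_lt_one hz1).hasSum).trans_lt h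

theorem bnorm_one_lt_top (hT : IsIsometricAutRep T) : bnorm hT.toIsIsometricRep (1 : B) < ∞ :=
  bnorm_lt_top_of_box _ (spectrumIn_one hT)

theorem bnorm_mul_lt_top (hT : IsIsometricAutRep T) {x y : B}
    (hx : bnorm hT.toIsIsometricRep x < ∞) (hy : bnorm hT.toIsIsometricRep y < ∞) :
    bnorm hT.toIsIsometricRep (x * y) < ∞ := by
  have hx' := (wnorm_le_bnorm _ x).trans_lt hx
  have hy' := (wnorm_le_bnorm _ y).trans_lt hy
  exact (bnorm_mul_le hT hx' hy').trans_lt (ENNReal.mul_lt_top (by simp)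
    (ENNReal.add_lt_top.2 ⟨ENNReal.mul_lt_top hx hy', ENNReal.mul_lt_top hx' hy⟩))

theorem bnorm_pow_lt_top (hT : IsIsometricAutRep T) {x : B}
    (hx : bnorm hT.toIsIsometricRep x < ∞) (n : ℕ) : bnorm hT.toIsIsometricRep (x ^ n) < ∞ := by
  induction n with
  | zero => rw [pow_zero]; exact bnorm_one_lt_top hT
  | succ n ih => rw [pow_succ]; exact bnorm_mul_lt_top hT ih hx

/-- The mixed estimate yields `bnorm (t^n) ≤ 4 bnorm t · 2^(-n)` for `n ≥ 1`; the induction closes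
because `4 · (1/4) + 1 = 4 · (1/2)`. -/
theorem tsum_bnorm_pow_lt_top (hT : IsIsometricAutRep T) {t : B}
    (ht : bnorm hT.toIsIsometricRep t < ∞) (ht' : 25 ^ d * wnorm hT.toIsIsometricRep t ≤ 1 / 4) :
    ∑' n, bnorm hT.toIsIsometricRep (t ^ n) < ∞ := by
  have hR := hT.toIsIsometricRep
  have hw := (wnorm_le_bnorm hR t).trans_lt ht
  have h1 : ∀ n, 25 ^ d * wnorm hR (t ^ (n + 1)) ≤ (1 / 4) ^ (n + 1) := by
    intro n
    induction n with
    | zero => simpa using ht'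
    | succ n ih =>
      rw [pow_succ, pow_succ (1 / 4 : ℝ≥0∞)]
      calc _ ≤ 25 ^ d * (5 ^ d * (wnorm hR (t ^ (n + 1)) * wnorm hR t)) := by
            gcongr
            exact wnorm_mul_le hT (wnorm_pow_lt_top hT hw _) hw
        _ ≤ 25 ^ d * (25 ^ d * (wnorm hR (t ^ (n + 1)) * wnorm hR t)) := by
            gcongr
            norm_num
        _ = (25 ^ d * wnorm hR (t ^ (n + 1))) * (25 ^ d * wnorm hR t) := by ring
        _ ≤ _ := by gcongr
  have h2 : ∀ n, bnorm hR (t ^ (n + 1)) ≤ 4 * bnorm hR t * (1 / 2) ^ (n + 1) := by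
    intro n
    induction n with
    | zero =>
      simp only [zero_add, pow_one]
      rw [mul_right_comm]
      refine le_mul_of_one_le_left' ?_
      rw [show (4 : ℝ≥0∞) = 2 * 2 by norm_num, mul_assoc, one_div,
        ENNReal.mul_inv_cancel (by simp) (by simp)]
      norm_num
    | succ n ih =>
      rw [pow_succ]
      calc _ ≤ _ := bnorm_mul_le hT (wnorm_pow_lt_top hT hw _) hw
        _ = bnorm hR (t ^ (n + 1)) * (25 ^ d * wnorm hR t) +
            (25 ^ d * wnorm hR (t ^ (n + 1))) * bnorm hR t := by ring
        _ ≤ (4 * bnorm hR t * (1 / 2) ^ (n + 1)) * (1 / 4) + (1 / 2) ^ (n + 1) * bnorm hR t := by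
            gcongr
            refine (h1 n).trans ?_
            gcongr
            norm_num
        _ = (4 * (1 / 4) + 1) * bnorm hR t * (1 / 2) ^ (n + 1) := by ring
        _ = 4 * (1 / 2) * bnorm hR t * (1 / 2) ^ (n + 1) := by
            congr 2
            rw [show (4 : ℝ≥0∞) * (1 / 2) = 2 * (2 * 2⁻¹) by rw [one_div]; ring, one_div,
              ENNReal.mul_inv_cancel (by simp) (by simp),
              ENNReal.mul_inv_cancel (by simp) (by simp)]
            norm_num
        _ = _ := by ring
  rw [tsum_eq_zero_add' ENNReal.summable]
  refine ENNReal.add_lt_top.2 ⟨?_, (ENNReal.tsum_le_tsum h2).trans_lt ?_⟩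
  · rw [pow_zero]; exact bnorm_one_lt_top hT
  · rw [ENNReal.tsum_mul_left]
    refine ENNReal.mul_lt_top (ENNReal.mul_lt_top (by simp) ht) ?_
    simp_rw [pow_succ]
    rw [ENNReal.tsum_mul_right, ENNReal.tsum_geometric]
    simp [ENNReal.mul_inv_cancel]

/-- The elements with finite discrete Wiener norm. -/
def wienerSubalgebra (hT : IsIsometricAutRep T) : Subalgebra ℂ B where
  carrier := {x | wnorm hT.toIsIsometricRep x < ∞}
  mul_mem' hx hy := (wnorm_mul_le hT hx hy).trans_lt
    (ENNReal.mul_lt_top (by simp) (ENNReal.mul_lt_top hx hy))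
  add_mem' hx hy := (wnorm_add_le _ _ _).trans_lt (ENNReal.add_lt_top.2 ⟨hx, hy⟩)
  algebraMap_mem' c := by
    rw [Algebra.algebraMap_eq_smul_one, Set.mem_ofPred_eq, wnorm_smul]
    exact ENNReal.mul_lt_top enorm_lt_top (spectrumIn_one hT).wnorm_lt_top

/-- The elements with finite Beurling norm. -/
def beurlingSubalgebra (hT : IsIsometricAutRep T) : Subalgebra ℂ B where
  carrier := {x | bnorm hT.toIsIsometricRep x < ∞}
  mul_mem' hx hy := bnorm_mul_lt_top hT hx hy
  add_mem' hx hy := (bnorm_add_le _ _ _).trans_lt (ENNReal.add_lt_top.2 ⟨hx, hy⟩)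
  algebraMap_mem' c := by
    rw [Algebra.algebraMap_eq_smul_one]
    exact (bnorm_smul_le _ _ _).trans_lt
      (ENNReal.mul_lt_top enorm_lt_top (bnorm_one_lt_top hT))

/-- Summability of the Wiener norms of the powers provides a `q` for which `z^q` meets the smallness
condition, and `1 - z` divides `1 - z^q`. -/
theorem exists_bnorm_mul_eq_one (hT : IsIsometricAutRep T) {z : B}
    (hz : bnorm hT.toIsIsometricRep z < ∞) (hz1 : ‖z‖ < 1) :
    ∃ v, bnorm hT.toIsIsometricRep v < ∞ ∧ (1 - z) * v = 1 := by
  have hR := hT.toIsIsometricRep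
  obtain ⟨N, hN, h⟩ := exists_tsum_wnorm_pow_lt_top hT ((wnorm_le_bnorm hR z).trans_lt hz) hz1
  have h0 := ENNReal.tendsto_atTop_zero_of_tsum_ne_top h.ne
  have h1 : Tendsto (fun n => 25 ^ d * ((2 * N + 5) ^ d *
      wnorm (hT.dilate N).toIsIsometricRep (z ^ n))) atTop (𝓝 0) := by
    have h2 := ENNReal.Tendsto.const_mul (a := (2 * N + 5) ^ d) h0
      (Or.inr (by exact_mod_cast ENNReal.natCast_ne_top _))
    have h3 := ENNReal.Tendsto.const_mul (a := 25 ^ d) h2 (Or.inr (by simp))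
    simpa using h3
  obtain ⟨q, hq, hq1⟩ := ((h1.eventually_le_const (u := 1 / 4) (by simp)).and
    (eventually_ge_atTop 1)).exists
  have hzq : ‖z ^ q‖ < 1 :=
    (norm_pow_le' z hq1).trans_lt (pow_lt_one₀ (norm_nonneg _) hz1 (by omega))
  have hS := tsum_bnorm_pow_lt_top hT (bnorm_pow_lt_top hT hz q) (le_trans (by
    gcongr; exact wnorm_le_dilate hT hN _) hq)
  refine ⟨(∑ i ∈ Finset.range q, z ^ i) * ∑' n, (z ^ q) ^ n, bnorm_mul_lt_top hT ?_ ?_, ?_⟩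
  · exact (beurlingSubalgebra hT).sum_mem fun i _ => (beurlingSubalgebra hT).pow_mem hz i
  · exact (bnorm_le_tsum _ (summable_geometric_of_norm_lt_one hzq).hasSum).trans_lt hS
  · rw [← mul_assoc, mul_neg_geom_sum, mul_neg_geom_series _ hzq]

/-- The truncations at scale `N` converge to `x` and are finite combinations of cells, each of
bounded spectrum. -/
theorem exists_bnorm_lt_top_norm_sub_lt (hT : IsIsometricAutRep T) (x : B) {ε : ℝ} (hε : 0 < ε) :
    ∃ y, bnorm hT.toIsIsometricRep y < ∞ ∧ ‖x - y‖ < ε := by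
  have hR := hT.toIsIsometricRep
  obtain ⟨N, hN, hN1⟩ := (((tendsto_cell_dilate hR x).eventually
    (Metric.ball_mem_nhds x hε)).and (eventually_ge_atTop 1)).exists
  refine ⟨_, ?_, by rwa [dist_comm, dist_eq_norm] at hN⟩
  have h0 : toReal (0 : Fin d → ℤ) = 0 := by ext; simp [toReal]
  rw [← h0, cell_dilate hR N hN1]
  refine (beurlingSubalgebra hT).sum_mem fun m _ => (beurlingSubalgebra hT).smul_mem ?_ _
  obtain ⟨r, hr⟩ := spectrumIn_cell hT m x
  exact bnorm_lt_top_of_box hR hr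

end Resolvents

/-! ### Equivalence of the integral and the discrete Wiener norms. -/

section Wiener

open Filter Topology

variable {d : ℕ}

/-- The half-open unit cube with lower corner `n`. -/
def cube (n : Fin d → ℤ) : Set (Fin d → ℝ) := Set.univ.pi fun k => Set.Ico (n k : ℝ) (n k + 1)

theorem mem_cube {n : Fin d → ℤ} {a : Fin d → ℝ} : a ∈ cube n ↔ ∀ k, ⌊a k⌋ = n k := by
  simp [cube, Set.mem_pi, Int.floor_eq_iff]

theorem measurableSet_cube (n : Fin d → ℤ) : MeasurableSet (cube n) :=
  MeasurableSet.univ_pi fun _ => measurableSet_Ico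

theorem volume_cube (n : Fin d → ℤ) : volume (cube n) = 1 := by
  rw [cube, Real.volume_pi_Ico]
  simp

theorem lintegral_cube (h : (Fin d → ℝ) → ℝ≥0∞) (n : Fin d → ℤ) :
    ∫⁻ a in cube n, h a = ∫⁻ θ in cube 0, h (toReal n + θ) := by
  have := (measurePreserving_add_left (volume : Measure (Fin d → ℝ))
    (toReal n)).setLIntegral_comp_preimage_emb
    (MeasurableEquiv.addLeft (toReal n)).measurableEmbedding h (cube n)
  rw [← this]
  congr 2
  ext a
  simp [mem_cube, toReal]

/-- The integral over `ℝ^d` is the integral over the unit cube of the periodization, which is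
therefore finite almost everywhere there. -/
theorem exists_tsum_lt_top {h : (Fin d → ℝ) → ℝ≥0∞} (hm : Measurable h)
    (hh : ∫⁻ a, h a < ∞) : ∃ θ, ∑' n : Fin d → ℤ, h (toReal n + θ) < ∞ := by
  have hs : ∀ n : Fin d → ℤ, Measurable fun θ => h (toReal n + θ) := fun n =>
    hm.comp (measurable_const_add _)
  have h1 : ∫⁻ θ in cube (0 : Fin d → ℤ), ∑' n : Fin d → ℤ, h (toReal n + θ) < ∞ := by
    rw [lintegral_tsum fun n => (hs n).aemeasurable]
    simp_rw [← lintegral_cube]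
    rw [← lintegral_iUnion measurableSet_cube]
    · exact (setLIntegral_le_lintegral _ _).trans_lt hh
    · intro m n hmn
      refine Set.disjoint_left.2 fun a ha hb => hmn ?_
      ext k
      rw [← mem_cube.1 ha k, mem_cube.1 hb k]
  have h2 := ae_lt_top (Measurable.tsum hs) h1.ne
  have : NeBot (ae (volume.restrict (cube (0 : Fin d → ℤ)))) := by
    rw [ae_neBot, Ne, Measure.restrict_eq_zero, volume_cube]
    exact one_ne_zero
  exact h2.exists

variable {B : Type*} [NormedRing B] [NormedAlgebra ℂ B] [CompleteSpace B]
  {T : (Fin d → ℝ) → B →L[ℂ] B}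

/-- The cell at `n` is seen by `phi a` only for `a` in a cube of side 6 about `n`. -/
theorem wienerNorm_lt_top_of_wnorm (hT : IsIsometricAutRep T) {x : B}
    (hx : wnorm hT.toIsIsometricRep x < ∞) : wienerNorm T x < ∞ := by
  have hR := hT.toIsIsometricRep
  let Q : (Fin d → ℤ) → Set (Fin d → ℝ) :=
    fun n => Set.univ.pi fun k => Set.Ioo (n k - 3 : ℝ) (n k + 3)
  have hQ : ∀ n, MeasurableSet (Q n) := fun n => MeasurableSet.univ_pi fun _ => measurableSet_Ioo
  have h1 : ∀ a, ‖act T (phi a) x‖ₑ ≤ ∑' n, (Q n).indicator (fun _ => coeff hR x n) a := by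
    intro a
    refine (enorm_le_tsum_enorm ((hasSum_cell_of_wnorm hR hx).mapL (cell hR a))).trans
      (ENNReal.tsum_le_tsum fun n => ?_)
    by_cases ha : a ∈ Q n
    · rw [Set.indicator_of_mem ha]
      exact enorm_cell_le hR a _
    · simp only [Q, Set.mem_univ_pi, not_forall] at ha
      obtain ⟨k, hk⟩ := ha
      rw [cell_cell_eq_zero hT (k := k), enorm_zero]
      · exact zero_le
      · by_contra! h
        rw [abs_lt] at h
        simp only [toReal] at h
        exact hk ⟨by linarith, by linarith⟩
  refine (lintegral_mono h1).trans_lt ?_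
  rw [lintegral_tsum fun n => (measurable_const.indicator (hQ n)).aemeasurable]
  have h2 : ∀ n, ∫⁻ a, (Q n).indicator (fun _ => coeff hR x n) a =
      coeff hR x n * ENNReal.ofReal 6 ^ d := by
    intro n
    rw [lintegral_indicator_const (hQ n), Real.volume_pi_Ioo]
    congr 1
    have : ∀ k, (n k + 3 - (n k - 3) : ℝ) = 6 := fun k => by ring
    simp [this]
  simp_rw [h2]
  rw [ENNReal.tsum_mul_right]
  exact ENNReal.mul_lt_top hx (by simp)

/-- For a suitable `θ` the cells along `ℤ^d + θ` are absolutely summable. By twisting they sum to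
`x`, and each meets at most `7 ^ d` integer cells. -/
theorem wnorm_lt_top_of_wienerNorm (hT : IsIsometricAutRep T) {x : B}
    (hx : wienerNorm T x < ∞) : wnorm hT.toIsIsometricRep x < ∞ := by
  classical
  have hR := hT.toIsIsometricRep
  obtain ⟨θ, hθ⟩ := exists_tsum_lt_top (continuous_act_phi hR x).enorm.measurable hx
  have h1 : wnorm (hR.twist θ) x < ∞ := by
    refine lt_of_eq_of_lt (tsum_congr fun n => ?_) hθ
    rw [coeff, cell_twist hR]
    rfl
  have h2 := hasSum_cell_of_wnorm (hR.twist θ) h1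
  simp only [cell_twist hR] at h2
  refine (wnorm_le_tsum hR h2).trans_lt ?_
  have h3 : ∀ n : Fin d → ℤ, wnorm hR (cell hR (toReal n + θ) x) ≤
      7 ^ d * ‖act T (phi (toReal n + θ)) x‖ₑ := by
    intro n
    refine (wnorm_le_card hR (s := (box d 3).image (· + (n + fun k => ⌊θ k⌋)))
      fun m hm => ?_).trans ?_
    · have hm' : m - (n + fun k => ⌊θ k⌋) ∉ box d 3 := fun h =>
        hm (Finset.mem_image.2 ⟨_, h, sub_add_cancel _ _⟩)
      rw [mem_box, not_forall] at hm'
      obtain ⟨k, hk⟩ := hm'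
      refine cell_cell_eq_zero hT (k := k) ?_ x
      by_contra! h
      apply hk
      rw [abs_lt] at h
      simp only [toReal, Pi.add_apply] at h
      have e1 := Int.floor_le (θ k)
      have e2 := Int.lt_floor_add_one (θ k)
      have e3 : (m k : ℝ) < n k + ⌊θ k⌋ + 4 := by linarith
      have e4 : (n k + ⌊θ k⌋ : ℝ) < m k + 3 := by linarith
      have e3' : m k < n k + ⌊θ k⌋ + 4 := by exact_mod_cast e3
      have e4' : n k + ⌊θ k⌋ < m k + 3 := by exact_mod_cast e4
      simp only [Pi.sub_apply, Pi.add_apply]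
      rw [abs_le]
      push_cast
      omega
    · refine mul_le_mul_left ?_ _
      have : ((box d 3).image (· + (n + fun k => ⌊θ k⌋))).card ≤ 7 ^ d :=
        Finset.card_image_le.trans_eq (card_box d 3)
      exact_mod_cast this
  refine (ENNReal.tsum_le_tsum h3).trans_lt ?_
  rw [ENNReal.tsum_mul_left]
  exact ENNReal.mul_lt_top (by simp) hθ

theorem coe_wienerSubalgebra (hT : IsIsometricAutRep T) :
    (wienerSubalgebra hT : Set B) = wiener T :=
  Set.ext fun _ => ⟨wienerNorm_lt_top_of_wnorm hT, wnorm_lt_top_of_wienerNorm hT⟩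

theorem coe_beurlingSubalgebra (hT : IsIsometricAutRep T) :
    (beurlingSubalgebra hT : Set B) = beurling T := rfl

theorem inv_mem_wienerSubalgebra (hT : IsIsometricAutRep T) (u : Bˣ)
    (hu : (u : B) ∈ wienerSubalgebra hT) : ((u⁻¹ : Bˣ) : B) ∈ wienerSubalgebra hT := by
  refine inv_mem_of_dense _ (fun x ε hε => ?_) (fun z hz hz1 => exists_wnorm_mul_eq_one hT hz hz1)
    u hu
  obtain ⟨y, hy, hxy⟩ := exists_bnorm_lt_top_norm_sub_lt hT x hε
  exact ⟨y, (wnorm_le_bnorm _ y).trans_lt hy, hxy⟩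

theorem inv_mem_beurlingSubalgebra (hT : IsIsometricAutRep T) (u : Bˣ)
    (hu : (u : B) ∈ beurlingSubalgebra hT) : ((u⁻¹ : Bˣ) : B) ∈ beurlingSubalgebra hT :=
  inv_mem_of_dense _ (fun x _ hε => exists_bnorm_lt_top_norm_sub_lt hT x hε)
    (fun _ hz hz1 => exists_bnorm_mul_eq_one hT hz hz1) u hu

end Wiener

/-! ### Generators as commuting derivations, and Sobolev classes. -/

section Sobolev

open Filter Topology

variable {d : ℕ}

section Rep

variable {X : Type*} [NormedAddCommGroup X] [NormedSpace ℂ X] {T : (Fin d → ℝ) → X →L[ℂ] X}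

theorem GenGraph.unique {k : Fin d} {x y z : X} (h : GenGraph T k x y) (h' : GenGraph T k x z) :
    y = z :=
  smul_right_injective X Complex.I_ne_zero (HasDerivAt.unique h h')

theorem WordGraph.unique {w : List (Fin d)} {x y z : X} (h : WordGraph T w x y)
    (h' : WordGraph T w x z) : y = z := by
  induction w generalizing y z with
  | nil => exact Eq.trans h (Eq.symm h')
  | cons k w ih =>
    obtain ⟨p, hp, hpy⟩ := h
    obtain ⟨q, hq, hqz⟩ := h'
    rw [ih hp hq] at hpy
    exact hpy.unique hqz

theorem wordGraph_append {v w : List (Fin d)} {x y : X} :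
    WordGraph T (v ++ w) x y ↔ ∃ z, WordGraph T w x z ∧ WordGraph T v z y := by
  induction v generalizing y with
  | nil =>
    refine ⟨fun h => ⟨y, h, rfl⟩, ?_⟩
    rintro ⟨z, hz, rfl⟩
    exact hz
  | cons k v ih =>
    constructor
    · rintro ⟨p, hp, hpy⟩
      obtain ⟨z, hz, hzp⟩ := ih.1 hp
      exact ⟨z, hz, p, hzp, hpy⟩
    · rintro ⟨z, hz, p, hzp, hpy⟩
      exact ⟨p, ih.2 ⟨z, hz, hzp⟩, hpy⟩

theorem wordGraph_singleton {k : Fin d} {x y : X} : WordGraph T [k] x y ↔ GenGraph T k x y := by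
  refine ⟨?_, fun h => ⟨x, rfl, h⟩⟩
  rintro ⟨z, rfl, h⟩
  exact h

theorem GenGraph.map {k : Fin d} {x y : X} (h : GenGraph T k x y) (hT : IsIsometricRep T)
    (s : Fin d → ℝ) : GenGraph T k (T s x) (T s y) := by
  have h1 := ((T s).restrictScalars ℝ).hasFDerivAt.comp_hasDerivAt (0 : ℝ) h
  have h2 : ((T s).restrictScalars ℝ) (Complex.I • y) = Complex.I • T s y := (T s).map_smul _ _
  rw [h2] at h1
  refine HasDerivAt.congr_of_eventuallyEq h1 (.of_forall fun t => ?_)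
  simp only [Function.comp_apply, ContinuousLinearMap.coe_restrictScalars']
  rw [← ContinuousLinearMap.comp_apply, ← ContinuousLinearMap.comp_apply, ← hT.map_add,
    ← hT.map_add, add_comm]

theorem GenGraph.sub {k : Fin d} {x y x' y' : X} (h : GenGraph T k x y)
    (h' : GenGraph T k x' y') : GenGraph T k (x - x') (y - y') := by
  have := HasDerivAt.sub h h'
  rw [← smul_sub] at this
  exact this.congr_of_eventuallyEq (.of_forall fun t => map_sub _ _ _)

theorem GenGraph.add {k : Fin d} {x y x' y' : X} (h : GenGraph T k x y)
    (h' : GenGraph T k x' y') : GenGraph T k (x + x') (y + y') := by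
  have := HasDerivAt.add h h'
  rw [← smul_add] at this
  exact this.congr_of_eventuallyEq (.of_forall fun t => map_add _ _ _)

theorem GenGraph.smul {k : Fin d} {x y : X} (h : GenGraph T k x y) (c : ℝ) :
    GenGraph T k (c • x) (c • y) := by
  have := HasDerivAt.const_smul c h
  rw [smul_comm] at this
  exact this.congr_of_eventuallyEq (.of_forall fun t => (T _).map_smul_of_tower c x)

theorem GenGraph.hasDerivAt {k : Fin d} {x y : X} (h : GenGraph T k x y) (hT : IsIsometricRep T)
    (s : ℝ) : HasDerivAt (fun t : ℝ => T (Pi.single k t) x) (T (Pi.single k s) (Complex.I • y))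
      s := by
  have h1 : HasDerivAt (fun t : ℝ => T (Pi.single k t) (T (Pi.single k s) x))
    (Complex.I • T (Pi.single k s) y) (s - s) := by rw [sub_self]; exact h.map hT _
  have h2 := h1.comp_sub_const s s
  rw [map_smul]
  refine h2.congr_of_eventuallyEq (.of_forall fun t => ?_)
  beta_reduce
  rw [← ContinuousLinearMap.comp_apply, ← hT.map_add, ← Pi.single_add, sub_add_cancel]

/-- The generators of the coordinate groups commute. -/
theorem GenGraph.swap (hT : IsIsometricRep T) {j k : Fin d} {x y z v : X} (hj : GenGraph T j x y)
    (hk : GenGraph T k x z) (hv : GenGraph T j z v) : GenGraph T k y v := by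
  have hT0 : T (Pi.single k 0) = ContinuousLinearMap.id ℂ X := by rw [Pi.single_zero, hT.map_zero]
  have lim : ∀ {p q : X}, GenGraph T j p q →
      Tendsto (fun t : ℝ => t⁻¹ • (T (Pi.single j t) p - p)) (𝓝[≠] 0) (𝓝 (Complex.I • q)) := by
    intro p q h
    have := hasDerivAt_iff_tendsto_slope_zero.1 h
    simpa [hT.map_zero] using this
  have hd : HasDerivAt (fun s : ℝ => T (Pi.single k s) (Complex.I • y))
      (T (Pi.single k 0) (Complex.I • Complex.I • v)) 0 := by
    -- Closedness of `A_k`: the difference quotients of `x` along `e_j` lie in its domain and tend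
    -- to `i y`, and their images tend to `i v`. Isometry makes the convergence uniform along
    -- orbits.
    refine hasDerivAt_of_tendstoUniformly (l := 𝓝[≠] (0 : ℝ))
      (f := fun t s => T (Pi.single k s) (t⁻¹ • (T (Pi.single j t) x - x)))
      (f' := fun t s => T (Pi.single k s) (Complex.I • t⁻¹ • (T (Pi.single j t) z - z)))
      (g' := fun s => T (Pi.single k s) (Complex.I • Complex.I • v)) ?_ ?_ ?_ 0
    · rw [Metric.tendstoUniformly_iff]
      intro ε hε
      have h1 := ((lim hv).const_smul Complex.I).eventually (Metric.ball_mem_nhds _ hε)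
      filter_upwards [h1] with t ht s
      rw [dist_eq_norm, ← map_sub, hT.norm_map, ← dist_eq_norm, dist_comm]
      exact ht
    · exact .of_forall fun t s => (((hk.map hT _).sub hk).smul t⁻¹).hasDerivAt hT s
    · intro s
      exact ((T (Pi.single k s)).continuous.tendsto _).comp (lim hj)
  have h2 := hd.const_smul (-Complex.I)
  have h3 : ∀ p : X, -Complex.I • Complex.I • p = p := fun p => by
    rw [smul_smul, neg_mul, Complex.I_mul_I, neg_neg, one_smul]
  rw [hT0, ContinuousLinearMap.id_apply, h3] at h2
  refine h2.congr_of_eventuallyEq (.of_forall fun s => ?_)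
  simp only [Pi.smul_apply, map_smul]
  rw [h3]

theorem GenGraph.wordGraph (hT : IsIsometricRep T) {k : Fin d} {w : List (Fin d)} {u v p q : X}
    (h : GenGraph T k u v) (hp : WordGraph T w u p) (hq : WordGraph T w v q) :
    GenGraph T k p q := by
  induction w generalizing p q with
  | nil =>
    rw [show p = u from hp, show q = v from hq]
    exact h
  | cons j w ih =>
    obtain ⟨p', hp', hpp⟩ := hp
    obtain ⟨q', hq', hqq⟩ := hq
    exact GenGraph.swap hT hpp (ih hp' hq') hqq

/-- Raising the exponent of `k` by one inserts one letter at the head of its block in the ordered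
word. -/
theorem exists_split_flatMap_replicate (α : Fin d → ℕ) (k : Fin d) :
    ∃ v w : List (Fin d),
      ((List.finRange d).flatMap fun j => List.replicate (α j) j) = v ++ w ∧
      ((List.finRange d).flatMap fun j => List.replicate ((α + Pi.single k 1 : Fin d → ℕ) j) j) =
        v ++ k :: w := by
  obtain ⟨l₁, l₂, hl⟩ := List.append_of_mem (List.mem_finRange k)
  have hnd := List.nodup_finRange d
  rw [hl] at hnd ⊢
  have hne : ∀ l : List (Fin d), k ∉ l →
      (l.flatMap fun j => List.replicate ((α + Pi.single k 1 : Fin d → ℕ) j) j) =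
        l.flatMap fun j => List.replicate (α j) j := by
    intro l hkl
    refine List.flatMap_congr fun j hj => ?_
    have : j ≠ k := fun h => hkl (h ▸ hj)
    simp [Pi.single_eq_of_ne this]
  have hnd' := List.nodup_middle.1 hnd
  rw [List.nodup_cons, List.mem_append, not_or] at hnd'
  refine ⟨l₁.flatMap fun j => List.replicate (α j) j,
    List.replicate (α k) k ++ l₂.flatMap fun j => List.replicate (α j) j, ?_, ?_⟩
  · rw [List.flatMap_append, List.flatMap_cons]
  · rw [List.flatMap_append, List.flatMap_cons, hne _ hnd'.1.1, hne _ hnd'.1.2, Pi.add_apply,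
      Pi.single_eq_same, List.replicate_succ, List.cons_append]

/-- If the ordered compositions of the generators up to order `m` are defined at `x`, then so are
all compositions, and they agree with the ordered ones. -/
theorem exists_powGraph_imp_wordGraph (hT : IsIsometricRep T) {m : ℕ} {x : X}
    (h : ∀ α : Fin d → ℕ, ∑ k, α k ≤ m → ∃ y, PowGraph T α x y) (w : List (Fin d))
    (hw : w.length ≤ m) :
    ∃ α : Fin d → ℕ, ∑ k, α k = w.length ∧ ∀ y, PowGraph T α x y → WordGraph T w x y := by
  induction w with
  | nil =>
    refine ⟨0, by simp, fun y hy => ?_⟩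
    have h0 : ((List.finRange d).flatMap fun j => List.replicate ((0 : Fin d → ℕ) j) j) = [] := by
      simp [List.flatMap_eq_nil_iff]
    rwa [PowGraph, h0] at hy
  | cons k w ih =>
    rw [List.length_cons] at hw
    obtain ⟨α, hα, hαw⟩ := ih (by omega)
    refine ⟨α + Pi.single k 1, ?_, fun y hy => ?_⟩
    · simp [Finset.sum_add_distrib, hα]
    obtain ⟨z, hz⟩ := h α (by omega)
    refine ⟨z, hαw z hz, ?_⟩
    obtain ⟨v₁, v₂, e1, e2⟩ := exists_split_flatMap_replicate α k
    rw [PowGraph, e2, wordGraph_append] at hy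
    rw [PowGraph, e1, wordGraph_append] at hz
    obtain ⟨v, ⟨u, hu, huv⟩, hvy⟩ := hy
    obtain ⟨u', hu', huz⟩ := hz
    rw [hu'.unique hu] at huz
    -- Commutation carries `A_k` from inside the ordered word to its front.
    exact huv.wordGraph hT huz hvy

/-- The class of the elements all of whose derivatives up to a given order exist and belong
to `F`. -/
def Smooth (T : (Fin d → ℝ) → X →L[ℂ] X) (F : Set X) : ℕ → X → Prop
  | 0, x => x ∈ F
  | n + 1, x => x ∈ F ∧ ∀ k, ∃ y, GenGraph T k x y ∧ Smooth T F n y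

theorem Smooth.of_succ {F : Set X} {n : ℕ} {x : X} (h : Smooth T F (n + 1) x) :
    Smooth T F n x := by
  induction n generalizing x with
  | zero => exact h.1
  | succ n ih =>
    refine ⟨h.1, fun k => ?_⟩
    obtain ⟨y, hy, hs⟩ := h.2 k
    exact ⟨y, hy, ih hs⟩

/-- The last letter of a word acts first, so the recursion peels words from the right. -/
theorem smooth_iff {F : Set X} {n : ℕ} {x : X} :
    Smooth T F n x ↔ ∀ w : List (Fin d), w.length ≤ n → ∃ y, WordGraph T w x y ∧ y ∈ F := by
  induction n generalizing x with
  | zero =>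
    constructor
    · intro h w hw
      rw [List.length_eq_zero_iff.1 (Nat.le_zero.1 hw)]
      exact ⟨x, rfl, h⟩
    · intro h
      obtain ⟨y, hy, hF⟩ := h [] le_rfl
      rwa [show y = x from hy] at hF
  | succ n ih =>
    constructor
    · intro h w hw
      rcases List.eq_nil_or_concat w with rfl | ⟨v, k, rfl⟩
      · exact ⟨x, rfl, h.1⟩
      · obtain ⟨y, hy, hs⟩ := h.2 k
        obtain ⟨z, hz, hF⟩ := ih.1 hs v (by simpa using hw)
        refine ⟨z, ?_, hF⟩
        rw [List.concat_eq_append, wordGraph_append]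
        exact ⟨y, wordGraph_singleton.2 hy, hz⟩
    · intro h
      constructor
      · obtain ⟨y, hy, hF⟩ := h [] (by simp)
        rwa [show y = x from hy] at hF
      · intro k
        obtain ⟨y, hy, -⟩ := h [k] (by simp)
        refine ⟨y, wordGraph_singleton.1 hy, ih.2 fun w hw => ?_⟩
        obtain ⟨z, hz, hF⟩ := h (w ++ [k]) (by simpa using hw)
        obtain ⟨y', hy', hz'⟩ := wordGraph_append.1 hz
        rw [hy'.unique hy] at hz'
        exact ⟨z, hz', hF⟩

/-- Replaces ordered monomials by iterated derivatives in any order, the form suited to induction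
with the Leibniz rule. -/
theorem mem_sobolev_iff (hT : IsIsometricRep T) {F : Set X} {m : ℕ} {x : X} :
    x ∈ sobolev T F m ↔ Smooth T F m x := by
  rw [smooth_iff]
  constructor
  · intro h w hw
    obtain ⟨α, hα, hαw⟩ := exists_powGraph_imp_wordGraph hT
      (fun α hα => (h α hα).imp fun _ hy => hy.1) w hw
    obtain ⟨y, hy, hF⟩ := h α (by omega)
    exact ⟨y, hαw y hy, hF⟩
  · intro h α hα
    refine h _ ?_
    rw [List.length_flatMap]
    simp only [List.length_replicate]
    rwa [← Fin.sum_univ_def]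

theorem Smooth.add {F : Set X} (hF : ∀ x ∈ F, ∀ y ∈ F, x + y ∈ F) {n : ℕ} {x y : X}
    (hx : Smooth T F n x) (hy : Smooth T F n y) : Smooth T F n (x + y) := by
  induction n generalizing x y with
  | zero => exact hF x hx y hy
  | succ n ih =>
    refine ⟨hF x hx.1 y hy.1, fun k => ?_⟩
    obtain ⟨x', h1, h1'⟩ := hx.2 k
    obtain ⟨y', h2, h2'⟩ := hy.2 k
    exact ⟨x' + y', h1.add h2, ih h1' h2'⟩

end Rep

section Alg

variable {B : Type*} [NormedRing B] [NormedAlgebra ℂ B] {T : (Fin d → ℝ) → B →L[ℂ] B}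

theorem GenGraph.mul (hT : IsIsometricAutRep T) {k : Fin d} {x y x' y' : B}
    (h : GenGraph T k x x') (h' : GenGraph T k y y') :
    GenGraph T k (x * y) (x' * y + x * y') := by
  have h1 := HasDerivAt.mul h h'
  simp only [Pi.single_zero, hT.map_zero, ContinuousLinearMap.id_apply] at h1
  rw [smul_mul_assoc, mul_smul_comm, ← smul_add] at h1
  exact h1.congr_of_eventuallyEq (.of_forall fun t => hT.map_mul _ _ _)

theorem genGraph_algebraMap (hT : IsIsometricAutRep T) (k : Fin d) (c : ℂ) :
    GenGraph T k (algebraMap ℂ B c) 0 := by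
  rw [GenGraph, smul_zero]
  refine (hasDerivAt_const (0 : ℝ) (algebraMap ℂ B c)).congr_of_eventuallyEq
    (.of_forall fun t => ?_)
  beta_reduce
  rw [Algebra.algebraMap_eq_smul_one, map_smul, hT.map_one]

theorem GenGraph.inv [CompleteSpace B] (hT : IsIsometricAutRep T) {k : Fin d} {u : Bˣ} {y : B}
    (h : GenGraph T k (u : B) y) :
    GenGraph T k ((u⁻¹ : Bˣ) : B) (-((u⁻¹ : Bˣ) * y * (u⁻¹ : Bˣ))) := by
  have h0 : T (Pi.single k (0 : ℝ)) (u : B) = u := by rw [Pi.single_zero, hT.map_zero]; rfl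
  have h1 := hasFDerivAt_ringInverse (𝕜 := ℝ) u
  rw [← h0] at h1
  have h2 := h1.comp_hasDerivAt (0 : ℝ) h
  have h3 : Complex.I • -(((u⁻¹ : Bˣ) : B) * y * (u⁻¹ : Bˣ)) =
      (-ContinuousLinearMap.mulLeftRight ℝ B ((u⁻¹ : Bˣ) : B) ((u⁻¹ : Bˣ) : B))
        (Complex.I • y) := by
    simp
  rw [GenGraph, h3]
  refine h2.congr_of_eventuallyEq (.of_forall fun t => ?_)
  -- An automorphism maps units to units, so `T` applied to `u⁻¹` is the ring inverse of `T` applied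
  -- to `u`.
  let v : Bˣ := ⟨T (Pi.single k t) u, T (Pi.single k t) (u⁻¹ : Bˣ),
    by rw [← hT.map_mul, Units.mul_inv, hT.map_one],
    by rw [← hT.map_mul, Units.inv_mul, hT.map_one]⟩
  exact (Ring.inverse_unit v).symm

theorem smooth_algebraMap (hT : IsIsometricAutRep T) (S : Subalgebra ℂ B) (n : ℕ) (c : ℂ) :
    Smooth T S n (algebraMap ℂ B c) := by
  induction n generalizing c with
  | zero => exact S.algebraMap_mem c
  | succ n ih =>
    refine ⟨S.algebraMap_mem c, fun k => ⟨0, genGraph_algebraMap hT k c, ?_⟩⟩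
    simpa using ih 0

theorem Smooth.mul (hT : IsIsometricAutRep T) {S : Subalgebra ℂ B} {n : ℕ} {x y : B}
    (hx : Smooth T S n x) (hy : Smooth T S n y) : Smooth T S n (x * y) := by
  induction n generalizing x y with
  | zero => exact S.mul_mem hx hy
  | succ n ih =>
    refine ⟨S.mul_mem hx.1 hy.1, fun k => ?_⟩
    obtain ⟨x', h1, h1'⟩ := hx.2 k
    obtain ⟨y', h2, h2'⟩ := hy.2 k
    exact ⟨_, h1.mul hT h2, (ih h1' hy.of_succ).add (fun _ ha _ hb => S.add_mem ha hb)
      (ih hx.of_succ h2')⟩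

/-- Each derivative `-u⁻¹ y u⁻¹` is a product of factors that have order `n` by induction, so only
closure under products is needed. -/
theorem Smooth.inv [CompleteSpace B] (hT : IsIsometricAutRep T) {S : Subalgebra ℂ B}
    (hS : ∀ u : Bˣ, (u : B) ∈ S → ((u⁻¹ : Bˣ) : B) ∈ S) {n : ℕ} {u : Bˣ}
    (hu : Smooth T S n (u : B)) : Smooth T S n ((u⁻¹ : Bˣ) : B) := by
  induction n with
  | zero => exact hS u hu
  | succ n ih =>
    refine ⟨hS u hu.1, fun k => ?_⟩
    obtain ⟨y, hy, hy'⟩ := hu.2 k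
    refine ⟨_, hy.inv hT, ?_⟩
    have h1 := ih hu.of_succ
    have h2 := (smooth_algebraMap hT S n (-1)).mul hT ((h1.mul hT hy').mul hT h1)
    rwa [map_neg, map_one, neg_one_mul] at h2

theorem isInverseClosedSubalgebra_sobolev [CompleteSpace B] (hT : IsIsometricAutRep T)
    (S : Subalgebra ℂ B) (hS : ∀ u : Bˣ, (u : B) ∈ S → ((u⁻¹ : Bˣ) : B) ∈ S) (m : ℕ) :
    IsInverseClosedSubalgebra (sobolev T (S : Set B) m) := by
  have hmem : ∀ x, x ∈ sobolev T (S : Set B) m ↔ Smooth T S m x := fun x =>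
    mem_sobolev_iff hT.toIsIsometricRep
  refine ⟨⟨{ carrier := {x | Smooth T S m x}
             mul_mem' := fun hx hy => Smooth.mul hT hx hy
             add_mem' := fun hx hy => Smooth.add (fun _ ha _ hb => S.add_mem ha hb) hx hy
             algebraMap_mem' := smooth_algebraMap hT S m }, ?_⟩, fun u hu => ?_⟩
  · exact Set.ext fun x => (hmem x).symm
  · rw [hmem] at hu ⊢
    exact hu.inv hT hS

end Alg

end Sobolev

end

end SpectralDecay

theorem theorem9p1 {d : ℕ} {B : Type*} [NormedRing B] [NormedAlgebra ℂ B] [CompleteSpace B]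
    (T : (Fin d → ℝ) → B →L[ℂ] B) (hT : SpectralDecay.IsIsometricAutRep T) (m : ℕ) :
    SpectralDecay.IsInverseClosedSubalgebra (SpectralDecay.sobolevWiener T m) ∧
      SpectralDecay.IsInverseClosedSubalgebra (SpectralDecay.sobolevBeurling T m) := by
  constructor
  · rw [SpectralDecay.sobolevWiener, ← SpectralDecay.coe_wienerSubalgebra hT]
    exact SpectralDecay.isInverseClosedSubalgebra_sobolev hT _
      (SpectralDecay.inv_mem_wienerSubalgebra hT) m
  · rw [SpectralDecay.sobolevBeurling, ← SpectralDecay.coe_beurlingSubalgebra hT]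
    exact SpectralDecay.isInverseClosedSubalgebra_sobolev hT _
      (SpectralDecay.inv_mem_beurlingSubalgebra hT) m
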